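/- Let $(M,g)$ be a connected Riemannian manifold (possibly with boundary) whose fundamental group is finite, $|\pi_1(M)|=\ell$. Let $\Sigma\subset M$ be a connected, properly embedded, two-sided smooth hypersurface with no boundary in the interior of $M$ (so either $\partial\Sigma=\emptyset$, or $\emptyset\ne\partial\Sigma\subset\partial M$); in particular $\Sigma$ may be any connected, complete, properly embedded, two-sided hypersurface without boundary. Let $N$ be a continuous unit normal vector field of $\Sigma$. Then $\Sigma$ is $\ell$-alternating, that is: for every differentiable curve $\gamma:[0,1]\to M$ with $\gamma(0),\gamma(1)\notin\Sigma$ which is transversal to $\Sigma$, the set $\gamma^{-1}(\Sigma)$ is finite and, writing $\gamma^{-1}(\Sigma)=\{t_1,\dots,t_n\}$ with $t_1<\dots<t_n$, one of the following holds: - either $\ell>n-1$; - or there is a $j\le \ell+1$ (with $1\le j\le n$) such that the numbers $g(\gamma'(t_1),N(\gamma(t_1)))$ and $g(\gamma'(t_j),N(\gamma(t_j)))$ have opposite signs. -/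

import Mathlib

open Set
open scoped Manifold ContDiff

/-- The model with corners `I` is a model for manifolds with (possibly empty) boundary: its range is
a closed half-space `{x | 0 ≤ L x}`. The case `L = 0` gives the whole space, that is, manifolds
without boundary; `L ≠ 0` gives manifolds with boundary (and excludes corners). -/
def IsBoundaryModel {E : Type*} [NormedAddCommGroup E] [NormedSpace ℝ E]
    {H : Type*} [TopologicalSpace H] (I : ModelWithCorners ℝ E H) : Prop :=
  ∃ L : E →L[ℝ] ℝ, range I = {x | 0 ≤ L x}

section Hypersurface

variable {E : Type*} [NormedAddCommGroup E] [NormedSpace ℝ E]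
  {H : Type*} [TopologicalSpace H] (I : ModelWithCorners ℝ E H)
  {M : Type*} [TopologicalSpace M] [ChartedSpace H M]
  {F : Type*} [NormedAddCommGroup F] [NormedSpace ℝ F]
  {G : Type*} [TopologicalSpace G] (J : ModelWithCorners ℝ F G)
  {S : Type*} [TopologicalSpace S] [ChartedSpace G S]

/-- `f : S → M` is a proper smooth embedding of the manifold `S` into the manifold `M`, and `S` has
no boundary in the interior of `M`. The embedded submanifold of `M` is `Set.range f`. -/
structure IsProperEmbedding (f : S → M) : Prop where
  contMDiff : ContMDiff J I ∞ f
  injective_mfderiv : ∀ s, Function.Injective (mfderiv J I f s)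
  isEmbedding : Topology.IsEmbedding f
  isProperMap : IsProperMap f
  mapsTo_boundary : MapsTo f (J.boundary S) (I.boundary M)

/-- The vectors of `T_p M` that are tangent to the submanifold `f(S)` at `p`: the image of `df_s`
where `f s = p`. -/
def tangentToImage (f : S → M) (p : M) : Set (TangentSpace I p) :=
  {v | ∃ w : TangentBundle J S, tangentMap J I f w = (⟨p, v⟩ : TangentBundle I M)}

/-- The velocity `γ'(t)` of a curve `γ : [0,1] → M`; the values of `γ` off `[0,1]` are ignored. -/
noncomputable def velocity (γ : ℝ → M) (t : ℝ) : TangentSpace I (γ t) :=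
  mfderivWithin 𝓘(ℝ, ℝ) I γ (Icc (0 : ℝ) 1) t (1 : ℝ)

/-- `γ : [0,1] → M` is transversal to the submanifold `f(S)`: `T_{γ(t)} M` is the sum of
`ℝ γ'(t)` and `T_{γ(t)} f(S)` whenever `γ(t)` lies in `f(S)`. -/
def IsTransversal (f : S → M) (γ : ℝ → M) : Prop :=
  ∀ t ∈ Icc (0 : ℝ) 1, γ t ∈ range f →
    ∀ v : TangentSpace I (γ t), ∃ c : ℝ, ∃ w ∈ tangentToImage I J f (γ t),
      v = c • velocity I γ t + w

variable [IsManifold I ∞ M]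

/-- `N` is a continuous unit normal vector field along the hypersurface `f(S)`, with respect to the
Riemannian metric `g`. Only the values of `N` at points of `f(S)` matter. -/
structure IsUnitNormalField
    (g : Bundle.ContMDiffRiemannianMetric I ∞ E (fun p : M ↦ TangentSpace I p))
    (f : S → M) (N : ∀ p : M, TangentSpace I p) : Prop where
  continuousOn : ContinuousOn (fun p ↦ (⟨p, N p⟩ : TangentBundle I M)) (range f)
  unit : ∀ p ∈ range f, g.inner p (N p) (N p) = 1
  normal : ∀ p ∈ range f, ∀ v ∈ tangentToImage I J f p, g.inner p (N p) v = 0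

/-- The hypersurface `f(S)`, with unit normal field `N`, is `ℓ`-alternating: for every
differentiable curve `γ : [0,1] → M` with ends off `f(S)` and transversal to `f(S)`, the set
`γ⁻¹(f(S))` is finite and, writing it as `{t₁ < ⋯ < tₙ}`, either `ℓ > n - 1` or there is
`j ≤ ℓ + 1` such that `g(γ'(t₁), N(γ(t₁)))` and `g(γ'(t_j), N(γ(t_j)))` have opposite signs.
The times are indexed from `0` here: the first one is `t i` with `i = 0`, and `t j` is the
`(j + 1)`-st one. -/
def IsAlternating
    (g : Bundle.ContMDiffRiemannianMetric I ∞ E (fun p : M ↦ TangentSpace I p))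
    (f : S → M) (N : ∀ p : M, TangentSpace I p) (ℓ : ℕ) : Prop :=
  ∀ γ : ℝ → M, MDifferentiableOn 𝓘(ℝ, ℝ) I γ (Icc (0 : ℝ) 1) →
    γ 0 ∉ range f → γ 1 ∉ range f → IsTransversal I J f γ →
    ∃ (n : ℕ) (t : Fin n → ℝ), StrictMono t ∧
      range t = {τ | τ ∈ Icc (0 : ℝ) 1 ∧ γ τ ∈ range f} ∧
      ((ℓ : ℤ) > (n : ℤ) - 1 ∨
        ∃ i j : Fin n, (i : ℕ) = 0 ∧ (j : ℕ) + 1 ≤ ℓ + 1 ∧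
          g.inner (γ (t i)) (velocity I γ (t i)) (N (γ (t i))) *
            g.inner (γ (t j)) (velocity I γ (t j)) (N (γ (t j))) < 0)

end Hypersurface

/-! A stronger fact holds: consecutive crossings of `γ` with the hypersurface always have opposite
signs. It suffices to find a continuous `κ : M → ℝ` whose zero set is exactly `range f` and which is
positive just on the side that `N` points to. At a crossing `κ ∘ γ` then changes sign in the
direction given by the sign of `g(γ', N)`, and it has no zero between consecutive crossings, so the
intermediate value theorem forces opposite signs.

Local side functions come from the inverse function theorem and are glued by a partition of unity to
a function `k` with the right signs near the hypersurface (`exists_continuous_sign_eq`); this rests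
on `IsHalfSpaceImmersion.eventually_sign_eq`. But `k` may have stray zeros. They are removed by
passing to the circle: a truncation of `±|k|` is continuous modulo `1`, with value `0` exactly on
the hypersurface. Finiteness of the fundamental group lifts this circle-valued map to `ℝ`;
connectedness of the hypersurface makes the lift a constant integer on it, and subtracting that
integer gives `κ` (`exists_continuous_zero_iff_of_finite_fundamentalGroup`).

At the boundary, the local analysis extends the parametrization across the half-space by reflection,
so that the inverse function theorem applies. -/

open Filter Topology

/-! ### Lifting circle-valued maps -/

/-- A continuous map to the circle `ℝ / ℤ` from a space with finite fundamental group lifts to `ℝ`. -/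
theorem exists_lift_of_finite_fundamentalGroup {X : Type*} [TopologicalSpace X]
    [PathConnectedSpace X] [LocallyPathConnectedSpace X] (x₀ : X) [Finite (FundamentalGroup X x₀)]
    (u : C(X, AddCircle (1 : ℝ))) :
    ∃ v : C(X, ℝ), ∀ x, ((v x : ℝ) : AddCircle (1 : ℝ)) = u x := by
  have hp := AddCircle.isAddQuotientCoveringMap_coe (1 : ℝ)
  have cov := AddCircle.isCoveringMap_coe (1 : ℝ)
  obtain ⟨e₀, he⟩ := QuotientAddGroup.mk_surjective (u x₀)
  have he' : ((e₀ : ℝ) : AddCircle (1 : ℝ)) = u x₀ := he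
  -- The induced map on fundamental groups is trivial: its source is finite, and that of the circle
  -- is the torsion-free deck group of `ℝ → ℝ / ℤ`.
  have htriv : ∀ a : FundamentalGroup X x₀, FundamentalGroup.map u x₀ a = 1 := by
    intro a
    have hfin : IsOfFinOrder (FundamentalGroup.map u x₀ a) :=
      MonoidHom.isOfFinOrder _ (isOfFinOrder_of_finite a)
    let e : (fun r : ℝ => (r : AddCircle (1 : ℝ))) ⁻¹' {u x₀} := ⟨e₀, he'⟩
    let φ := hp.fundamentalGroupEquiv e
    have h2 : IsOfFinOrder (φ (FundamentalGroup.map u x₀ a)) :=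
      MonoidHom.isOfFinOrder φ.toMonoidHom hfin
    have h3 : φ (FundamentalGroup.map u x₀ a) = 1 := by
      rw [isOfFinOrder_iff_pow_eq_one] at h2
      obtain ⟨n, hn, h⟩ := h2
      have h4 := congrArg (fun z => Multiplicative.toAdd (MulOpposite.unop z)) h
      simp only [MulOpposite.unop_pow, toAdd_pow, MulOpposite.unop_one, toAdd_one] at h4
      have h5 := (smul_eq_zero.mp (h4)).resolve_left hn.ne'
      exact MulOpposite.unop_injective (Multiplicative.toAdd.injective h5)
    exact φ.injective (h3.trans (map_one φ).symm)
  obtain ⟨F, ⟨-, hF⟩, -⟩ := cov.existsUnique_continuousMap_lifts_of_range_le (f := u) he'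
    (by rintro _ ⟨a, rfl⟩; rw [htriv]; exact one_mem _)
  exact ⟨F, fun x => congrFun hF x⟩

/-! ### Gluing local functions with prescribed signs -/

/-- Local functions whose signs agree near a closed set `Z` are glued into one continuous function
with these signs. -/
theorem exists_continuous_sign_eq {X : Type*} [TopologicalSpace X] [NormalSpace X]
    [ParacompactSpace X] {Z : Set X} (hZ : IsClosed Z) (P : (X → ℝ) → X → Prop)
    (hex : ∀ p ∈ Z, ∃ θ : X → ℝ, ∀ᶠ q in 𝓝 p, ContinuousAt θ q ∧ (q ∈ Z → P θ q))
    (hsign : ∀ q ∈ Z, ∀ θ θ', P θ q → P θ' q →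
      ∀ᶠ y in 𝓝 q, SignType.sign (θ y) = SignType.sign (θ' y)) :
    ∃ k : C(X, ℝ), ∀ q ∈ Z, ∀ θ, P θ q →
      ∀ᶠ y in 𝓝 q, SignType.sign (k y) = SignType.sign (θ y) := by
  have hex' : ∀ p : Z, ∃ (θ : X → ℝ) (U : Set X), IsOpen U ∧ (p : X) ∈ U ∧
      ∀ q ∈ U, ContinuousAt θ q ∧ (q ∈ Z → P θ q) := by
    intro p
    obtain ⟨θ, hθ⟩ := hex p p.2
    obtain ⟨U, h1, h2, h3⟩ := mem_nhds_iff.mp hθ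
    exact ⟨θ, U, h2, h3, h1⟩
  choose θ U hUo hpU hU using hex'
  obtain ⟨ρ, hρ⟩ := PartitionOfUnity.exists_isSubordinate hZ U hUo
    (fun x hx => mem_iUnion.mpr ⟨⟨x, hx⟩, hpU ⟨x, hx⟩⟩)
  have hk : Continuous fun x => ∑ᶠ i, ρ i x • θ i x :=
    ρ.continuous_finsum_smul fun i x hx => (hU i x (hρ i hx)).1
  refine ⟨⟨_, hk⟩, fun q hq θ' hθ' => ?_⟩
  -- The weights sum to `1` only on `Z`; near `Z` positivity of the sum is enough for signs.
  have hpos : ∀ᶠ y in 𝓝 q, 0 < ∑ i ∈ ρ.fintsupport q, ρ i y := by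
    have hc : Continuous fun y => ∑ i ∈ ρ.fintsupport q, ρ i y :=
      continuous_finsetSum _ fun i _ => (ρ i).continuous
    refine hc.continuousAt.eventually (lt_mem_nhds ?_)
    exact one_pos.trans_eq (ρ.sum_finsupport' hq (ρ.finsupport_subset_fintsupport q)).symm
  -- The finite set `fintsupport q` contains the active indices at all points near `q`, and its
  -- members still have `q` in their `U i`.
  have hall : ∀ᶠ y in 𝓝 q, ∀ i ∈ ρ.fintsupport q,
      SignType.sign (θ i y) = SignType.sign (θ' y) := by
    rw [eventually_all_finset]
    intro i hi
    exact hsign q hq _ _ ((hU i q (hρ i ((ρ.mem_fintsupport_iff q i).mp hi))).2 hq) hθ'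
  filter_upwards [hpos, hall, ρ.eventually_finsupport_subset q] with y hy hs hsub
  have heq : ∑ᶠ i, ρ i y • θ i y = ∑ i ∈ ρ.fintsupport q, ρ i y * θ i y := by
    rw [finsum_eq_sum_of_support_subset (s := ρ.fintsupport q)]
    · simp only [smul_eq_mul]
    · intro i hi
      refine hsub ((ρ.mem_finsupport y).mpr fun h => hi ?_)
      simp [h]
  change SignType.sign (∑ᶠ i, ρ i y • θ i y) = _
  rw [heq]
  have hnn : ∀ i, 0 ≤ ρ i y := fun i => ρ.nonneg i y
  obtain ⟨j, hj, hjpos⟩ := Finset.exists_lt_of_sum_lt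
    (by simpa using hy : ∑ i ∈ ρ.fintsupport q, (0 : ℝ) < ∑ i ∈ ρ.fintsupport q, ρ i y)
  rcases lt_trichotomy (θ' y) 0 with h | h | h
  · have hneg : ∀ i ∈ ρ.fintsupport q, θ i y < 0 := fun i hi => by
      have := hs i hi; rw [sign_neg h] at this; exact sign_eq_neg_one_iff.mp this
    rw [sign_neg h, sign_eq_neg_one_iff]
    exact Finset.sum_neg' (fun i hi => mul_nonpos_of_nonneg_of_nonpos (hnn i) (hneg i hi).le)
      ⟨j, hj, mul_neg_of_pos_of_neg hjpos (hneg j hj)⟩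
  · have hz : ∀ i ∈ ρ.fintsupport q, θ i y = 0 := fun i hi => by
      have := hs i hi; rw [h, sign_zero] at this; exact sign_eq_zero_iff.mp this
    rw [h, Finset.sum_eq_zero fun i hi => by rw [hz i hi, mul_zero]]
  · have hp : ∀ i ∈ ρ.fintsupport q, 0 < θ i y := fun i hi => by
      have := hs i hi; rw [sign_pos h] at this; exact sign_eq_one_iff.mp this
    rw [sign_pos h, sign_eq_one_iff]
    exact Finset.sum_pos' (fun i hi => mul_nonneg (hnn i) (hp i hi).le)
      ⟨j, hj, mul_pos hjpos (hp j hj)⟩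

/-! ### Removing stray zeros through the circle -/

theorem AddCircle.coe_one_eq_zero_iff {r : ℝ} :
    (r : AddCircle (1 : ℝ)) = 0 ↔ ∃ n : ℤ, (n : ℝ) = r := by
  rw [AddCircle.coe_eq_zero_iff]; simp

theorem AddCircle.coe_one_injOn_abs_lt {r s : ℝ} (hr : |r| < 1 / 2) (hs : |s| < 1 / 2)
    (h : (r : AddCircle (1 : ℝ)) = s) : r = s := by
  have h0 : ((r - s : ℝ) : AddCircle (1 : ℝ)) = 0 := by
    rw [AddCircle.coe_sub, h, sub_self]
  obtain ⟨n, hn⟩ := AddCircle.coe_one_eq_zero_iff.mp h0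
  rw [abs_lt] at hr hs
  have h1 : (n : ℝ) < 1 := by linarith [hr.1, hr.2, hs.1, hs.2]
  have h2 : (-1 : ℝ) < n := by linarith [hr.1, hr.2, hs.1, hs.2]
  have h1' : n < 1 := by exact_mod_cast h1
  have h2' : -1 < n := by exact_mod_cast h2
  have : n = 0 := by omega
  rw [this] at hn
  push_cast at hn
  linarith

/-- In a space with finite fundamental group, a continuous function vanishing near a connected
closed set `Z` exactly on `Z` can be replaced by one that has the same signs near `Z` and vanishes
nowhere else. -/
theorem exists_continuous_zero_iff_of_finite_fundamentalGroup {X : Type*} [TopologicalSpace X]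
    [NormalSpace X] [PathConnectedSpace X] [LocallyPathConnectedSpace X] (x₀ : X)
    [Finite (FundamentalGroup X x₀)] {Z : Set X} (hZ : IsClosed Z) (hZc : IsConnected Z)
    (k : C(X, ℝ)) (hk : ∀ q ∈ Z, ∀ᶠ y in 𝓝 q, k y = 0 ↔ y ∈ Z) :
    ∃ κ : C(X, ℝ), (∀ y, κ y = 0 ↔ y ∈ Z) ∧
      ∀ q ∈ Z, ∀ᶠ y in 𝓝 q, SignType.sign (κ y) = SignType.sign (k y) := by
  obtain ⟨q₀, hq₀⟩ := hZc.nonempty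
  set W : Set X := interior {y | k y = 0 ↔ y ∈ Z} with hW
  have hZW : Z ⊆ W := fun q hq => mem_interior_iff_mem_nhds.mpr (hk q hq)
  obtain ⟨α, hα0, hα1, -⟩ := exists_continuous_zero_one_of_isClosed hZ isOpen_interior.isClosed_compl
    (disjoint_compl_right_iff_subset.mpr hZW)
  -- Stray zeros of `k` lie off `W`, where `α = 1`. Hence `d` vanishes only on `Z` and equals the
  -- cap `1 / 2` near every stray zero.
  let d : X → ℝ := fun y => min (max |k y| (α y)) (1 / 2)
  have hd : Continuous d := by fun_prop
  have hd0 : ∀ y, 0 ≤ d y := fun y =>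
    le_min ((abs_nonneg _).trans (le_max_left _ _)) (by norm_num)
  have hdle : ∀ y, d y ≤ 1 / 2 := fun y => min_le_right _ _
  have hkZ : ∀ y ∈ Z, k y = 0 := fun y hy => (interior_subset (hZW hy)).mpr hy
  have hdZ : ∀ y, d y = 0 ↔ y ∈ Z := by
    intro y
    constructor
    · intro h
      have h1 : max |k y| (α y) ≤ 0 := by
        by_contra! h'
        have : 0 < d y := lt_min h' (by norm_num)
        linarith
      have hk0 : k y = 0 := abs_eq_zero.mp (le_antisymm ((le_max_left _ _).trans h1) (abs_nonneg _))
      have hyW : y ∈ W := by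
        by_contra hy
        have := hα1 hy
        simp only [Pi.one_apply] at this
        linarith [(le_max_right |k y| (α y)).trans h1]
      exact (interior_subset hyW).mp hk0
    · intro h
      have h1 : α y = 0 := hα0 h
      simp [d, hkZ y h, h1]
  -- `v` can jump only at stray zeros, from `-1 / 2` to `1 / 2`, and these agree modulo `1`.
  let v : X → ℝ := fun y => if 0 < k y then d y else -d y
  have hvabs : ∀ y, |v y| = d y := by
    intro y
    by_cases h : 0 < k y <;> simp [v, h, abs_of_nonneg (hd0 y)]
  have hhalf : ((-(1 / 2) : ℝ) : AddCircle (1 : ℝ)) = ((1 / 2 : ℝ) : AddCircle (1 : ℝ)) := by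
    have : ((1 / 2 - -(1 / 2) : ℝ) : AddCircle (1 : ℝ)) = 0 :=
      AddCircle.coe_one_eq_zero_iff.mpr ⟨1, by norm_num⟩
    rw [AddCircle.coe_sub, sub_eq_zero] at this
    exact this.symm
  have hcoe : Continuous ((↑) : ℝ → AddCircle (1 : ℝ)) := AddCircle.continuous_mk' 1
  have hu : Continuous fun y => (v y : AddCircle (1 : ℝ)) := by
    rw [continuous_iff_continuousAt]
    intro y
    rcases lt_trichotomy (k y) 0 with h | h | h
    · have : (fun y => ((-d y : ℝ) : AddCircle (1 : ℝ))) =ᶠ[𝓝 y] fun y => (v y : AddCircle (1 : ℝ)) := by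
        filter_upwards [k.continuous.continuousAt.eventually (gt_mem_nhds h)] with z hz
        simp [v, not_lt.mpr hz.le]
      exact (hcoe.comp hd.neg).continuousAt.congr this
    · by_cases hy : y ∈ Z
      · have hv : ContinuousAt v y := by
          have h0 : v y = 0 := abs_eq_zero.mp ((hvabs y).trans ((hdZ y).mpr hy))
          rw [ContinuousAt, h0]
          refine (tendsto_zero_iff_abs_tendsto_zero v).mpr ?_
          have := hd.tendsto y
          rw [(hdZ y).mpr hy] at this
          exact this.congr fun z => (hvabs z).symm
        exact hcoe.continuousAt.comp hv
      · have hyW : y ∉ W := fun h' => hy ((interior_subset h').mp h)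
        have h1 : α y = 1 := hα1 hyW
        have hα : ∀ᶠ z in 𝓝 y, 1 / 2 < α z :=
          α.continuous.continuousAt.eventually (lt_mem_nhds (by rw [h1]; norm_num))
        refine (continuousAt_const (y := ((1 / 2 : ℝ) : AddCircle (1 : ℝ)))).congr ?_
        filter_upwards [hα] with z hz
        have hdz : d z = 1 / 2 := min_eq_right (hz.le.trans (le_max_right _ _))
        by_cases hkz : 0 < k z
        · simp only [v, hkz, if_true, hdz]
        · simp only [v, hkz, if_false, hdz, hhalf]
    · have : (fun y => ((d y : ℝ) : AddCircle (1 : ℝ))) =ᶠ[𝓝 y] fun y => (v y : AddCircle (1 : ℝ)) := by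
        filter_upwards [k.continuous.continuousAt.eventually (lt_mem_nhds h)] with z hz
        simp [v, hz]
      exact (hcoe.comp hd).continuousAt.congr this
  obtain ⟨w, hw⟩ := exists_lift_of_finite_fundamentalGroup x₀ ⟨_, hu⟩
  simp only [ContinuousMap.coe_mk] at hw
  -- Since `|v| ≤ 1 / 2`, the only integer value of `v` is `0`.
  have hwZ : ∀ y, (∃ n : ℤ, (n : ℝ) = w y) ↔ y ∈ Z := by
    intro y
    rw [← AddCircle.coe_one_eq_zero_iff, hw, AddCircle.coe_one_eq_zero_iff]
    constructor
    · rintro ⟨n, hn⟩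
      have h1 : |(n : ℝ)| ≤ 1 / 2 := by rw [hn, hvabs]; exact hdle y
      have h2 : |(n : ℝ)| < 1 := by linarith
      have h3 : n = 0 := by
        have : |n| < 1 := by exact_mod_cast h2
        exact Int.abs_lt_one_iff.mp this
      rw [← hdZ, ← hvabs, ← hn, h3]
      simp
    · intro h
      exact ⟨0, by rw [Int.cast_zero, eq_comm, ← abs_eq_zero, hvabs, hdZ]; exact h⟩
  obtain ⟨n₀, hn₀⟩ := (hwZ q₀).mpr hq₀
  have hconst : ∀ y ∈ Z, w y = n₀ := by
    have hdisc : IsDiscrete (range ((↑) : ℤ → ℝ)) := ⟨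
      Int.isClosedEmbedding_coe_real.isEmbedding.toHomeomorph.symm.isEmbedding.discreteTopology⟩
    intro y hy
    rw [hn₀]
    exact hZc.isPreconnected.constant_of_mapsTo hdisc
      w.continuous.continuousOn (fun z hz => (hwZ z).mpr hz) hy hq₀
  refine ⟨⟨fun y => w y - n₀, by fun_prop⟩, fun y => ⟨fun h => (hwZ y).mp ⟨n₀, ?_⟩, fun h => ?_⟩,
    fun q hq => ?_⟩
  · simp only [ContinuousMap.coe_mk] at h; linarith
  · simp [hconst y h]
  · have h1 : ∀ᶠ y in 𝓝 q, |w y - n₀| < 1 / 2 := by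
      have hc : Continuous fun y => |w y - n₀| := by fun_prop
      exact hc.continuousAt.eventually (gt_mem_nhds (by simp [hconst q hq]))
    have h2 : ∀ᶠ y in 𝓝 q, d y < 1 / 2 :=
      hd.continuousAt.eventually (gt_mem_nhds (by rw [(hdZ q).mpr hq]; norm_num))
    filter_upwards [h1, h2, hk q hq] with y hy1 hy2 hy3
    have heq : w y - n₀ = v y := by
      refine AddCircle.coe_one_injOn_abs_lt hy1 (by rw [hvabs]; exact hy2) ?_
      rw [AddCircle.coe_sub, hw, AddCircle.coe_one_eq_zero_iff.mpr ⟨n₀, rfl⟩, sub_zero]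
    simp only [ContinuousMap.coe_mk, heq]
    rcases lt_trichotomy (k y) 0 with h | h | h
    · have hdy : 0 < d y := lt_of_le_of_ne (hd0 y) fun h' =>
        h.ne (hy3.mpr ((hdZ y).mp h'.symm))
      rw [sign_neg h, sign_eq_neg_one_iff]
      simp only [v, not_lt.mpr h.le, if_false]; linarith
    · have : v y = 0 := abs_eq_zero.mp ((hvabs y).trans ((hdZ y).mpr (hy3.mp h)))
      rw [this, h]
    · have hdy : 0 < d y := lt_of_le_of_ne (hd0 y) fun h' =>
        h.ne' (hy3.mpr ((hdZ y).mp h'.symm))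
      rw [sign_pos h, sign_eq_one_iff]
      simpa only [v, h, if_true] using hdy

/-! ### Extension across the boundary of a half-space -/

/-- Extension of a function defined on the half-space `{x | 0 ≤ l x}` by reflection, with a quadratic
correction in the direction of `-w`; the vector `e` satisfies `l e = 1`. -/
noncomputable def halfSpaceExtension {F E : Type*} [NormedAddCommGroup F] [NormedSpace ℝ F]
    [NormedAddCommGroup E] [NormedSpace ℝ E] (l : F →L[ℝ] ℝ) (e : F) (w : E) (f : F → E) (x : F) :
    E :=
  if 0 ≤ l x then f x
  else (2 : ℝ) • f (x - l x • e) - f (x - (2 * l x) • e) - (l x) ^ 2 • w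

section

variable {F E : Type*} [NormedAddCommGroup F] [NormedSpace ℝ F]
  [NormedAddCommGroup E] [NormedSpace ℝ E]

theorem uniqueDiffOn_halfSpace {l : F →L[ℝ] ℝ} {e : F} (he : l e = 1) :
    UniqueDiffOn ℝ {x | 0 ≤ l x} := by
  refine uniqueDiffOn_convex ?_ ⟨e, ?_⟩
  · exact convex_halfSpace_ge l.isLinear 0
  · refine mem_interior.mpr ⟨{x | 0 < l x}, fun x (hx : 0 < l x) => hx.le,
      isOpen_lt continuous_const l.continuous, ?_⟩
    change 0 < l e
    rw [he]; exact one_pos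

/-- Let `π` be the projection to the boundary and `σ` the reflection, both along `e`. They fix the
boundary and satisfy `2π - σ = id`, so `2 f ∘ π - f ∘ σ` matches `f` there in value and derivative;
the quadratic term vanishes to first order. -/
theorem contDiffAt_halfSpaceExtension {l : F →L[ℝ] ℝ} {e : F} (he : l e = 1) (w : E) {f : F → E}
    {x₀ : F} (hx₀ : l x₀ = 0) (hf : ContDiffWithinAt ℝ 1 f {x | 0 ≤ l x} x₀) :
    ContDiffAt ℝ 1 (halfSpaceExtension l e w f) x₀ := by
  set D : Set F := {x | 0 ≤ l x} with hD
  have hDx₀ : x₀ ∈ D := hx₀.ge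
  have hDc : IsClosed D := isClosed_le continuous_const l.continuous
  have hDuniq : UniqueDiffOn ℝ D := uniqueDiffOn_halfSpace he
  obtain ⟨u, hu, -, hfu⟩ := hf.contDiffOn le_rfl (by simp)
  rw [insert_eq_of_mem hDx₀] at hu
  obtain ⟨B, hBo, hxB, hBu⟩ := mem_nhdsWithin.mp hu
  have hfB : ContDiffOn ℝ 1 f (D ∩ B) := hfu.mono (by rwa [inter_comm])
  set f' : F → F →L[ℝ] E := fderivWithin ℝ f D with hf'
  have hfd : ∀ x ∈ D ∩ B, HasFDerivWithinAt f (f' x) D x := fun x hx =>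
    (((hfB.differentiableOn one_ne_zero) x hx).mono_of_mem_nhdsWithin
      (inter_mem_nhdsWithin D (hBo.mem_nhds hx.2))).hasFDerivWithinAt
  have hfc : ContinuousOn f' (D ∩ B) :=
    (hfB.continuousOn_fderivWithin (hDuniq.inter hBo) le_rfl).congr
      fun x hx => (fderivWithin_inter (hBo.mem_nhds hx.2)).symm
  let π : F →L[ℝ] F := ContinuousLinearMap.id ℝ F - l.smulRight e
  let σ : F →L[ℝ] F := ContinuousLinearMap.id ℝ F - (2 : ℝ) • l.smulRight e
  have hπ : ∀ x, π x = x - l x • e := fun x => by simp [π]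
  have hσ : ∀ x, σ x = x - (2 * l x) • e := fun x => by simp [σ, mul_smul]
  set D' : Set F := {x | l x ≤ 0} with hD'
  have hDc' : IsClosed D' := isClosed_le l.continuous continuous_const
  have hπD : ∀ x, π x ∈ D := fun x => by simp [hπ, hD, he]
  have hσD : ∀ x ∈ D', σ x ∈ D := fun x (hx : l x ≤ 0) => by
    simp only [hσ, hD, mem_ofPred_eq, map_sub, map_smul, he, smul_eq_mul, mul_one]; linarith
  set V : Set F := B ∩ (π ⁻¹' B ∩ σ ⁻¹' B) with hV
  have hVo : IsOpen V := hBo.inter ((hBo.preimage π.continuous).inter (hBo.preimage σ.continuous))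
  have hxV : x₀ ∈ V := ⟨hxB, by simpa [hπ, hx₀] using hxB, by simpa [hσ, hx₀] using hxB⟩
  let g' : F → F →L[ℝ] E := fun x =>
    (2 : ℝ) • (f' (π x)).comp π - (f' (σ x)).comp σ - (2 * l x) • l.smulRight w
  let φ' : F → F →L[ℝ] E := fun x => if 0 ≤ l x then f' x else g' x
  have hfix : ∀ x, l x = 0 → π x = x ∧ σ x = x := fun x hx => by simp [hπ, hσ, hx]
  have hφD : ∀ x ∈ D, φ' x = f' x := fun x hx => if_pos hx
  have hφD' : ∀ x ∈ D', φ' x = g' x := by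
    intro x (hx : l x ≤ 0)
    by_cases h : 0 ≤ l x
    · have h0 : l x = 0 := le_antisymm hx h
      rw [hφD x h]
      ext v
      simp only [g', (hfix x h0).1, (hfix x h0).2, h0]
      simp [hπ, hσ, two_smul, mul_smul]
      abel
    · exact if_neg h
  have hED : EqOn (halfSpaceExtension l e w f) f D := fun x hx => if_pos hx
  have hED' : EqOn (halfSpaceExtension l e w f)
      (fun x => (2 : ℝ) • f (π x) - f (σ x) - (l x) ^ 2 • w) D' := by
    intro x (hx : l x ≤ 0)
    by_cases h : 0 ≤ l x
    · have h0 : l x = 0 := le_antisymm hx h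
      rw [hED h]
      simp [(hfix x h0).1, (hfix x h0).2, h0, two_smul]
    · simp only [halfSpaceExtension, if_neg h, hπ, hσ]
  have hDD' : D ∪ D' = univ := eq_univ_of_forall fun x => le_total 0 (l x)
  have hder : ∀ x ∈ V, HasFDerivAt (halfSpaceExtension l e w f) (φ' x) x := by
    intro x hx
    have h1 : HasFDerivWithinAt (halfSpaceExtension l e w f) (φ' x) D x := by
      by_cases hxD : x ∈ D
      · rw [hφD x hxD]
        exact (hfd x ⟨hxD, hx.1⟩).congr hED (hED hxD)
      · exact .of_notMem_closure (by rwa [hDc.closure_eq])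
    have h2 : HasFDerivWithinAt (halfSpaceExtension l e w f) (φ' x) D' x := by
      by_cases hxD : x ∈ D'
      · rw [hφD' x hxD]
        refine HasFDerivWithinAt.congr ?_ hED' (hED' hxD)
        have ha := (hfd (π x) ⟨hπD x, hx.2.1⟩).comp x (π.hasFDerivWithinAt (s := D'))
          (fun y _ => hπD y)
        have hb := (hfd (σ x) ⟨hσD x hxD, hx.2.2⟩).comp x (σ.hasFDerivWithinAt (s := D')) hσD
        have hc : HasFDerivWithinAt (fun y => (l y) ^ 2 • w) ((2 * l x) • l.smulRight w) D' x := by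
          have := ((l.hasFDerivAt (x := x)).pow 2).smul_const w
          refine (this.congr_fderiv ?_).hasFDerivWithinAt
          ext v; simp [mul_smul]
        exact ((ha.const_smul (2 : ℝ)).sub hb).sub hc
      · exact .of_notMem_closure (by rwa [hDc'.closure_eq])
    have h3 := h1.union h2
    rwa [hDD', hasFDerivWithinAt_univ] at h3
  have hcont : ContinuousOn φ' V := by
    have h1 : ContinuousOn φ' (V ∩ D) :=
      (hfc.mono fun x hx => ⟨hx.2, hx.1.1⟩).congr fun x hx => hφD x hx.2
    have h2 : ContinuousOn φ' (V ∩ D') := by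
      refine ContinuousOn.congr ?_ fun x hx => hφD' x hx.2
      have ha : ContinuousOn (fun x => f' (π x)) (V ∩ D') :=
        hfc.comp π.continuous.continuousOn fun x hx => ⟨hπD x, hx.1.2.1⟩
      have hb : ContinuousOn (fun x => f' (σ x)) (V ∩ D') :=
        hfc.comp σ.continuous.continuousOn fun x hx => ⟨hσD x hx.2, hx.1.2.2⟩
      have hc : ContinuousOn (fun x => (2 * l x) • l.smulRight w) (V ∩ D') := by fun_prop
      exact (((ha.clm_comp continuousOn_const).const_smul (2 : ℝ)).sub
        (hb.clm_comp continuousOn_const)).sub hc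
    intro x hx
    have h3 : ContinuousWithinAt φ' (V ∩ D) x := by
      by_cases hxD : x ∈ D
      · exact h1 x ⟨hx, hxD⟩
      · exact continuousWithinAt_of_notMem_closure fun h =>
          hxD (hDc.closure_eq ▸ closure_mono inter_subset_right h)
    have h4 : ContinuousWithinAt φ' (V ∩ D') x := by
      by_cases hxD : x ∈ D'
      · exact h2 x ⟨hx, hxD⟩
      · exact continuousWithinAt_of_notMem_closure fun h =>
          hxD (hDc'.closure_eq ▸ closure_mono inter_subset_right h)
    have h5 := h3.union h4
    rwa [← inter_union_distrib_left, hDD', inter_univ] at h5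
  exact contDiffAt_one_iff.mpr ⟨φ', V, hVo.mem_nhds hxV, hcont, hder⟩

/-- A function into the half-space `{y | 0 ≤ L y}` that is `C¹` on the half-space `{x | 0 ≤ l x}`
near `x₀` and maps the boundary to the boundary extends to a `C¹` function that maps the rest of a
neighborhood of `x₀` outside of the half-space `{y | 0 ≤ L y}`. -/
theorem exists_contDiffAt_extension {l : F →L[ℝ] ℝ} {L : E →L[ℝ] ℝ} {f : F → E} {x₀ : F}
    (hx₀ : 0 ≤ l x₀) (hf : ContDiffWithinAt ℝ 1 f {x | 0 ≤ l x} x₀)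
    (hmaps : ∀ᶠ x in 𝓝 x₀, 0 ≤ l x → 0 ≤ L (f x))
    (hbd : l ≠ 0 → l x₀ = 0 → L ≠ 0 ∧ ∀ᶠ x in 𝓝 x₀, l x = 0 → L (f x) = 0) :
    ∃ f₁ : F → E, ContDiffAt ℝ 1 f₁ x₀ ∧ (∀ x, 0 ≤ l x → f₁ x = f x) ∧
      ∀ᶠ x in 𝓝 x₀, l x < 0 → L (f₁ x) < 0 := by
  by_cases hl : l = 0
  · subst hl
    refine ⟨f, ?_, fun _ _ => rfl, by simp⟩
    simpa [← contDiffWithinAt_univ] using hf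
  rcases hx₀.lt_or_eq with h | h
  · have hev : ∀ᶠ x in 𝓝 x₀, 0 < l x := l.continuous.continuousAt.eventually (lt_mem_nhds h)
    refine ⟨f, hf.contDiffAt (hev.mono fun x hx => le_of_lt hx), fun _ _ => rfl, ?_⟩
    filter_upwards [hev] with x hx hx'
    exact absurd hx hx'.not_gt
  · obtain ⟨hL, hbd⟩ := hbd hl h.symm
    obtain ⟨v, hv⟩ : ∃ v, l v ≠ 0 := by
      by_contra! h'; exact hl (ContinuousLinearMap.ext h')
    obtain ⟨w, hw⟩ : ∃ w, L w ≠ 0 := by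
      by_contra! h'; exact hL (ContinuousLinearMap.ext h')
    let e : F := (l v)⁻¹ • v
    have he : l e = 1 := by simp [e, hv]
    let w' : E := (L w)⁻¹ • w
    have hw' : L w' = 1 := by simp [w', hw]
    refine ⟨halfSpaceExtension l e w' f, contDiffAt_halfSpaceExtension he w' h.symm hf,
      fun x hx => if_pos hx, ?_⟩
    have h1 : Tendsto (fun x => x - l x • e) (𝓝 x₀) (𝓝 x₀) := by
      have : Continuous fun x => x - l x • e := by fun_prop
      simpa [← h] using this.tendsto x₀
    have h2 : Tendsto (fun x => x - (2 * l x) • e) (𝓝 x₀) (𝓝 x₀) := by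
      have : Continuous fun x => x - (2 * l x) • e := by fun_prop
      simpa [← h] using this.tendsto x₀
    -- Where `l x < 0`, the projected point contributes `0` to `L` and the reflected one a
    -- nonpositive amount, so the quadratic term makes `L` strictly negative.
    filter_upwards [h1.eventually hbd, h2.eventually hmaps] with x hx1 hx2 hx
    have hx1' := hx1 (by simp [he])
    have hx2' := hx2 (by simp [he]; linarith)
    simp only [halfSpaceExtension, if_neg hx.not_ge, map_sub, map_smul, hx1', hw', smul_eq_mul]
    nlinarith [sq_pos_of_neg hx]

end

/-! ### Hypersurfaces of a half-space and signs of defining functions -/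

section

variable {F E : Type*} [NormedAddCommGroup F] [NormedSpace ℝ F]
  [NormedAddCommGroup E] [NormedSpace ℝ E]

/-- A `C¹` function on a convex set is strictly differentiable within this set. -/
theorem exists_forall_abs_sub_sub_le_of_contDiffWithinAt {h : E → ℝ} {R : Set E} {y₀ : E}
    (hR : Convex ℝ R) (hy₀ : y₀ ∈ R) (hu : UniqueDiffOn ℝ R) (hh : ContDiffWithinAt ℝ 1 h R y₀)
    {ε : ℝ} (hε : 0 < ε) :
    ∃ δ > 0, ContinuousOn h (R ∩ Metric.ball y₀ δ) ∧
      ∀ y ∈ R ∩ Metric.ball y₀ δ, ∀ z ∈ R ∩ Metric.ball y₀ δ,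
        |h z - h y - fderivWithin ℝ h R y₀ (z - y)| ≤ ε * ‖z - y‖ := by
  obtain ⟨u, hu', -, hhu⟩ := hh.contDiffOn le_rfl (by simp)
  rw [insert_eq_of_mem hy₀] at hu'
  obtain ⟨B, hBo, hyB, hBu⟩ := mem_nhdsWithin.mp hu'
  have hhB : ContDiffOn ℝ 1 h (R ∩ B) := hhu.mono (by rwa [inter_comm])
  have hd : ∀ x ∈ R ∩ B, HasFDerivWithinAt h (fderivWithin ℝ h R x) R x := fun x hx =>
    (((hhB.differentiableOn one_ne_zero) x hx).mono_of_mem_nhdsWithin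
      (inter_mem_nhdsWithin R (hBo.mem_nhds hx.2))).hasFDerivWithinAt
  have hc : ContinuousOn (fderivWithin ℝ h R) (R ∩ B) :=
    (hhB.continuousOn_fderivWithin (hu.inter hBo) le_rfl).congr
      fun x hx => (fderivWithin_inter (hBo.mem_nhds hx.2)).symm
  have hev : ∀ᶠ x in 𝓝[R ∩ B] y₀, dist (fderivWithin ℝ h R x) (fderivWithin ℝ h R y₀) < ε :=
    (hc y₀ ⟨hy₀, hyB⟩).eventually (Metric.ball_mem_nhds _ hε)
  have hRB : 𝓝[R ∩ B] y₀ = 𝓝[R] y₀ := by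
    rw [inter_comm]
    exact nhdsWithin_inter_of_mem (mem_nhdsWithin_of_mem_nhds (hBo.mem_nhds hyB))
  rw [hRB, eventually_nhdsWithin_iff] at hev
  obtain ⟨δ, hδ, hball⟩ := Metric.eventually_nhds_iff_ball.mp (hev.and (hBo.mem_nhds hyB))
  have hsub : R ∩ Metric.ball y₀ δ ⊆ R ∩ B := fun x hx => ⟨hx.1, (hball x hx.2).2⟩
  refine ⟨δ, hδ, hhB.continuousOn.mono hsub, fun y hy z hz => ?_⟩
  exact (hR.inter (convex_ball y₀ δ)).norm_image_sub_le_of_norm_hasFDerivWithin_le'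
    (fun x hx => (hd x (hsub hx)).mono inter_subset_left)
    (fun x hx => by rw [← dist_eq_norm]; exact ((hball x hx.2).1 hx.1).le) hy hz

theorem eq_zero_of_apply_add_smul_eq_zero {A : F →L[ℝ] E} (hA : Function.Injective A) {ν : E}
    (hν : ν ∉ range A) {x : F} {t : ℝ} (h : A x + t • ν = 0) : (x, t) = 0 := by
  have ht : t = 0 := by
    by_contra ht
    refine hν ⟨-(t⁻¹ • x), ?_⟩
    rw [map_neg, map_smul, eq_neg_of_add_eq_zero_left h, smul_neg, neg_neg, smul_smul,
      inv_mul_cancel₀ ht, one_smul]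
  rw [ht, zero_smul, add_zero] at h
  rw [ht, (injective_iff_map_eq_zero _).mp hA x h]; rfl

/-- Coordinates near a `C¹` immersed hypersurface: `τ` is the coordinate in the transversal
direction `ν`. -/
theorem exists_transversal_coordinate [FiniteDimensional ℝ F] [FiniteDimensional ℝ E]
    (hdim : Module.finrank ℝ E = Module.finrank ℝ F + 1) {f : F → E} {x₀ : F}
    (hf : ContDiffAt ℝ 1 f x₀) (hinj : Function.Injective (fderiv ℝ f x₀)) {ν : E}
    (hν : ν ∉ range (fderiv ℝ f x₀)) :
    ∃ τ : E → ℝ, ContDiffAt ℝ 1 τ (f x₀) ∧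
      (∀ᶠ p : F × ℝ in 𝓝 (x₀, 0), τ (f p.1 + p.2 • ν) = p.2) ∧
      ∀ O ∈ 𝓝 x₀, ∀ᶠ y in 𝓝 (f x₀), ∃ x ∈ O, y = f x + τ y • ν := by
  -- `Φ` is a local diffeomorphism by injectivity and the dimension count; `τ` is the second
  -- component of its inverse.
  let Φ : F × ℝ → E := fun p => f p.1 + p.2 • ν
  have hΦ : ContDiffAt ℝ 1 Φ (x₀, 0) := by
    refine ContDiffAt.add (ContDiffAt.comp (x₀, (0 : ℝ)) hf contDiffAt_fst) ?_
    exact contDiffAt_snd.smul contDiffAt_const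
  have hΦ₀ : Φ (x₀, 0) = f x₀ := by simp [Φ]
  let A' : F × ℝ →L[ℝ] E := (fderiv ℝ f x₀).comp (ContinuousLinearMap.fst ℝ F ℝ) +
    (ContinuousLinearMap.snd ℝ F ℝ).smulRight ν
  have hA' : ∀ p, A' p = fderiv ℝ f x₀ p.1 + p.2 • ν := fun p => by simp [A']
  have hder : HasFDerivAt Φ A' (x₀, 0) := by
    have h1 : HasFDerivAt (fun p : F × ℝ => f p.1)
        ((fderiv ℝ f x₀).comp (ContinuousLinearMap.fst ℝ F ℝ)) (x₀, 0) :=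
      HasFDerivAt.comp (x₀, (0 : ℝ)) (hf.differentiableAt one_ne_zero).hasFDerivAt hasFDerivAt_fst
    exact h1.add (hasFDerivAt_snd.smul_const ν)
  have hA'inj : Function.Injective A' := by
    rw [injective_iff_map_eq_zero]
    rintro ⟨x, t⟩ h
    exact eq_zero_of_apply_add_smul_eq_zero hinj hν (by rwa [hA'] at h)
  let A : (F × ℝ) ≃L[ℝ] E :=
    (LinearEquiv.ofInjectiveOfFinrankEq A'.toLinearMap hA'inj (by simp [hdim])).toContinuousLinearEquiv
  have hA : (A : F × ℝ →L[ℝ] E) = A' := by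
    ext p <;> rfl
  have hder' : HasFDerivAt Φ (A : F × ℝ →L[ℝ] E) (x₀, 0) := by rwa [hA]
  let e := hΦ.toOpenPartialHomeomorph Φ hder' one_ne_zero
  have he : ∀ p, e p = Φ p := fun p => rfl
  have hmem : (x₀, (0 : ℝ)) ∈ e.source := hΦ.mem_toOpenPartialHomeomorph_source hder' one_ne_zero
  have htgt : f x₀ ∈ e.target := by
    rw [← hΦ₀]; exact e.map_source hmem
  have hsymm₀ : e.symm (f x₀) = (x₀, 0) := by
    rw [← hΦ₀]; exact e.left_inv hmem
  refine ⟨fun y => (e.symm y).2, ?_, ?_, fun O hO => ?_⟩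
  · have : ContDiffAt ℝ 1 e.symm (f x₀) := by
      have := hΦ.to_localInverse hder' one_ne_zero
      rw [hΦ₀] at this
      exact this
    exact contDiffAt_snd.comp _ this
  · filter_upwards [e.open_source.mem_nhds hmem] with p hp
    change (e.symm (e p)).2 = p.2
    rw [e.left_inv hp]
  · have hc : Tendsto (fun y => (e.symm y).1) (𝓝 (f x₀)) (𝓝 x₀) := by
      have h1 := (continuous_fst.tendsto _).comp (e.continuousAt_symm htgt)
      rwa [hsymm₀] at h1
    filter_upwards [hc hO, e.open_target.mem_nhds htgt] with y hy hyt
    exact ⟨(e.symm y).1, hy, (e.right_inv hyt).symm⟩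

/-- `f` parametrizes near `x₀` the subset `Z` of the half-space `{y | 0 ≤ L y}` by the half-space
`{x | 0 ≤ l x}`, and maps the complement of this half-space to the complement of
`{y | 0 ≤ L y}`. -/
structure IsHalfSpaceImmersion (l : F →L[ℝ] ℝ) (L : E →L[ℝ] ℝ) (Z : Set E) (f : F → E) (x₀ : F) :
    Prop where
  nonneg : 0 ≤ l x₀
  contDiffAt : ContDiffAt ℝ 1 f x₀
  injective : Function.Injective (fderiv ℝ f x₀)
  maps_nonneg : ∀ᶠ x in 𝓝 x₀, 0 ≤ l x → 0 ≤ L (f x)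
  maps_neg : ∀ᶠ x in 𝓝 x₀, l x < 0 → L (f x) < 0
  mem : ∀ᶠ x in 𝓝 x₀, 0 ≤ l x → f x ∈ Z
  exists_eq : ∀ O ∈ 𝓝 x₀, ∀ᶠ y in 𝓝 (f x₀), y ∈ Z → ∃ x ∈ O, 0 ≤ l x ∧ f x = y

namespace IsHalfSpaceImmersion

variable {l : F →L[ℝ] ℝ} {L : E →L[ℝ] ℝ} {Z : Set E} {f : F → E} {x₀ : F}

/-- A zero of `τ` has the form `f x`. If `l x` were negative, `f x` would lie outside the
half-space, so the extended part of `f` adds no zeros there. -/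
theorem eventually_eq_zero_iff (hf : IsHalfSpaceImmersion l L Z f x₀) {ν : E} {τ : E → ℝ}
    (hτ : ∀ᶠ p : F × ℝ in 𝓝 (x₀, 0), τ (f p.1 + p.2 • ν) = p.2)
    (hτ' : ∀ O ∈ 𝓝 x₀, ∀ᶠ y in 𝓝 (f x₀), ∃ x ∈ O, y = f x + τ y • ν) :
    ∀ᶠ y in 𝓝 (f x₀), 0 ≤ L y → (τ y = 0 ↔ y ∈ Z) := by
  have h0 : ∀ᶠ x in 𝓝 x₀, τ (f x) = 0 := by
    have : Tendsto (fun x : F => (x, (0 : ℝ))) (𝓝 x₀) (𝓝 (x₀, 0)) :=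
      (Continuous.prodMk_left (0 : ℝ)).tendsto x₀
    filter_upwards [this.eventually hτ] with x hx
    simpa using hx
  filter_upwards [hτ' _ (hf.maps_neg.and hf.mem), hf.exists_eq _ h0] with y hy hyZ hLy
  constructor
  · intro hy0
    obtain ⟨x, ⟨hneg, hmem⟩, hx⟩ := hy
    rw [hy0, zero_smul, add_zero] at hx
    rw [hx]
    refine hmem (not_lt.mp fun hlx => ?_)
    have := hneg hlx
    rw [← hx] at this
    exact this.not_ge hLy
  · intro hy'
    obtain ⟨x, hx, -, rfl⟩ := hyZ hy'
    exact hx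

/-- Write `y = f x + τ y • ν`. If `τ y < 0`, then `f x` stays in the half-space because `0 ≤ L ν`,
and strict differentiability compares `h y` with `h (f x) = 0`. If `τ y > 0`, then `f x` may lie
outside; instead `y` is pushed along `ν`, which stays inside and meets no zero, to a point where `h
> 0`. -/
theorem eventually_sign_eq_coordinate (hf : IsHalfSpaceImmersion l L Z f x₀)
    (hu : UniqueDiffOn ℝ {y | 0 ≤ L y}) {ν : E} (hLν : 0 ≤ L ν) {τ : E → ℝ}
    (hτcont : ContinuousAt τ (f x₀))
    (hτ : ∀ᶠ p : F × ℝ in 𝓝 (x₀, 0), τ (f p.1 + p.2 • ν) = p.2)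
    (hτ' : ∀ O ∈ 𝓝 x₀, ∀ᶠ y in 𝓝 (f x₀), ∃ x ∈ O, y = f x + τ y • ν)
    {h : E → ℝ} (hh : ContDiffWithinAt ℝ 1 h {y | 0 ≤ L y} (f x₀))
    (hZ : ∀ᶠ y in 𝓝 (f x₀), 0 ≤ L y → (h y = 0 ↔ y ∈ Z))
    (hν : 0 < fderivWithin ℝ h {y | 0 ≤ L y} (f x₀) ν) :
    ∀ᶠ y in 𝓝 (f x₀), 0 ≤ L y → SignType.sign (h y) = SignType.sign (τ y) := by
  have hZτ := hf.eventually_eq_zero_iff hτ hτ'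
  set R : Set E := {y | 0 ≤ L y} with hR
  set h' := fderivWithin ℝ h R (f x₀) with hh'
  have hRc : Convex ℝ R := convex_halfSpace_ge L.isLinear 0
  have hy₀ : f x₀ ∈ R := hf.maps_nonneg.self_of_nhds hf.nonneg
  have hν0 : 0 < ‖ν‖ := norm_pos_iff.mpr fun h0 => by simp [h0] at hν
  -- With this `ε`, the error along `t • ν` is at most a quarter of the main term `|t| * h' ν`.
  obtain ⟨δ, hδ, hcont, hstrict⟩ := exists_forall_abs_sub_sub_le_of_contDiffWithinAt
    hRc hy₀ hu hh (ε := h' ν / (4 * ‖ν‖)) (by positivity)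
  obtain ⟨r, hr, hball⟩ := Metric.eventually_nhds_iff_ball.mp (hZ.and hZτ)
  obtain ⟨ρ, hρ, hcoord⟩ := Metric.eventually_nhds_iff_ball.mp hτ
  have hcoord' : ∀ x ∈ Metric.ball x₀ ρ, ∀ t : ℝ, |t| < ρ → τ (f x + t • ν) = t := by
    intro x hx t ht
    refine hcoord (x, t) ?_
    rw [← ball_prod_same]
    exact ⟨hx, by simpa using ht⟩
  obtain ⟨K, hK, hKρ, hKδ, hKr⟩ : ∃ K > 0, K ≤ ρ / 2 ∧ K * ‖ν‖ ≤ δ / 2 ∧ K * ‖ν‖ ≤ r / 2 := by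
    refine ⟨min (ρ / 2) (min (δ / 2) (r / 2) / ‖ν‖), by positivity, min_le_left _ _, ?_, ?_⟩
    · exact (le_div_iff₀ hν0).mp ((min_le_right _ _).trans (by gcongr; exact min_le_left _ _))
    · exact (le_div_iff₀ hν0).mp ((min_le_right _ _).trans (by gcongr; exact min_le_right _ _))
  have h0 : h (f x₀) = 0 :=
    ((hball _ (Metric.mem_ball_self hr)).1 hy₀).mpr (hf.mem.self_of_nhds hf.nonneg)
  have hfball : ∀ᶠ x in 𝓝 x₀, f x ∈ Metric.ball (f x₀) (min δ r) :=
    hf.contDiffAt.continuousAt.eventually (Metric.ball_mem_nhds _ (by positivity))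
  -- `K` is fixed before `y`, so `y` can be taken close enough that its offset from `f x₀` is
  -- negligible against `K * h' ν`.
  have hlim : ∀ᶠ y in 𝓝 (f x₀), |h' (y - f x₀)| +
      h' ν / (4 * ‖ν‖) * ‖y - f x₀‖ < K * h' ν / 2 := by
    have hc : Continuous fun y => |h' (y - f x₀)| + h' ν / (4 * ‖ν‖) * ‖y - f x₀‖ := by fun_prop
    exact hc.continuousAt.eventually (gt_mem_nhds (by simp; positivity))
  have hτc : ∀ᶠ y in 𝓝 (f x₀), ∃ x ∈ {x | x ∈ Metric.ball x₀ ρ ∧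
      f x ∈ Metric.ball (f x₀) (min δ r) ∧ (0 ≤ l x → 0 ≤ L (f x)) ∧ (l x < 0 → L (f x) < 0) ∧
      (0 ≤ l x → f x ∈ Z)}, y = f x + τ y • ν :=
    hτ' _ (Filter.Eventually.and (Metric.ball_mem_nhds x₀ hρ)
      (hfball.and (hf.maps_nonneg.and (hf.maps_neg.and hf.mem))))
  have hτsmall : ∀ᶠ y in 𝓝 (f x₀), |τ y| < ρ / 2 := by
    have hτ0 : τ (f x₀) = 0 := by simpa using hτ.self_of_nhds
    exact hτcont.abs.eventually (gt_mem_nhds (by simp only [hτ0, abs_zero]; positivity))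
  filter_upwards [hτc, hτsmall, hlim, Metric.ball_mem_nhds (f x₀) (half_pos hδ),
    Metric.ball_mem_nhds (f x₀) (half_pos hr)] with y ⟨x, ⟨hxρ, hfx, hxnn, hxneg, hxZ⟩, hyx⟩
    hty hly hyδ hyr hLy
  have hyball := hball y (Metric.ball_subset_ball (half_le_self hr.le) hyr)
  rcases lt_trichotomy (τ y) 0 with ht | ht | ht
  · have hlx : 0 ≤ l x := by
      by_contra! hlx
      have h1 : L y = L (f x) + τ y * L ν := by
        conv_lhs => rw [hyx]
        simp
      nlinarith [hxneg hlx, mul_nonneg (neg_nonneg.mpr ht.le) hLν]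
    have hfxR := hxnn hlx
    have hfx0 : h (f x) = 0 :=
      ((hball (f x) (Metric.ball_subset_ball (min_le_right _ _) hfx)).1 hfxR).mpr (hxZ hlx)
    have h1 := hstrict (f x) ⟨hfxR, Metric.ball_subset_ball (min_le_left _ _) hfx⟩ y
      ⟨hLy, Metric.ball_subset_ball (half_le_self hδ.le) hyδ⟩
    have h2 : y - f x = τ y • ν := by
      conv_lhs => rw [hyx]
      simp
    rw [h2, map_smul, hfx0, norm_smul, Real.norm_eq_abs, abs_of_neg ht, smul_eq_mul] at h1
    have h3 : h' ν / (4 * ‖ν‖) * (-τ y * ‖ν‖) = -τ y * h' ν / 4 := by field_simp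
    rw [h3] at h1
    have h4 := (abs_le.mp h1).2
    rw [sign_neg ht, sign_eq_neg_one_iff]
    nlinarith
  · rw [ht, sign_zero, sign_eq_zero_iff, hyball.1 hLy, ← hyball.2 hLy, ht]
  · have hpath : ∀ s ∈ Icc (0 : ℝ) K, (y + s • ν) ∈ R ∧ y + s • ν ∈ Metric.ball (f x₀) δ ∧
        h (y + s • ν) ≠ 0 := by
      intro s hs
      have hsR : y + s • ν ∈ R := by
        change 0 ≤ L (y + s • ν)
        rw [map_add, map_smul, smul_eq_mul]
        exact add_nonneg hLy (mul_nonneg hs.1 hLν)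
      have hsn : ‖s • ν‖ ≤ K * ‖ν‖ := by
        rw [norm_smul, Real.norm_eq_abs, abs_of_nonneg hs.1]
        exact mul_le_mul_of_nonneg_right hs.2 hν0.le
      have hdist : ∀ {a : ℝ}, K * ‖ν‖ ≤ a / 2 → y ∈ Metric.ball (f x₀) (a / 2) →
          y + s • ν ∈ Metric.ball (f x₀) a := by
        intro a ha hya
        rw [Metric.mem_ball, dist_eq_norm] at hya ⊢
        calc ‖y + s • ν - f x₀‖ = ‖(y - f x₀) + s • ν‖ := by congr 1; abel
          _ ≤ ‖y - f x₀‖ + ‖s • ν‖ := norm_add_le _ _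
          _ < a := by linarith
      have hτs : τ (y + s • ν) = τ y + s := by
        have h1 : y + s • ν = f x + (τ y + s) • ν := by
          rw [add_smul, ← add_assoc, ← hyx]
        rw [h1]
        refine hcoord' x hxρ _ ?_
        rw [abs_of_pos (by linarith [hs.1])]
        rw [abs_of_pos ht] at hty
        linarith [hs.2]
      refine ⟨hsR, hdist hKδ hyδ, fun h0 => ?_⟩
      have hb := hball _ (hdist hKr hyr)
      have := (hb.2 hsR).mpr ((hb.1 hsR).mp h0)
      linarith [hs.1]
    have hend : 0 < h (y + K • ν) := by
      have hKmem := hpath K ⟨hK.le, le_rfl⟩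
      have h1 := hstrict (f x₀) ⟨hy₀, Metric.mem_ball_self hδ⟩ _ ⟨hKmem.1, hKmem.2.1⟩
      have h2 : y + K • ν - f x₀ = (y - f x₀) + K • ν := by abel
      rw [h2, map_add, map_smul, h0, smul_eq_mul] at h1
      have h3 : ‖(y - f x₀) + K • ν‖ ≤ ‖y - f x₀‖ + K * ‖ν‖ := by
        refine (norm_add_le _ _).trans ?_
        rw [norm_smul, Real.norm_eq_abs, abs_of_pos hK]
      have h4 : h' ν / (4 * ‖ν‖) * ‖(y - f x₀) + K • ν‖ ≤
          h' ν / (4 * ‖ν‖) * ‖y - f x₀‖ + K * h' ν / 4 := by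
        refine (mul_le_mul_of_nonneg_left h3 (by positivity)).trans (le_of_eq ?_)
        field_simp
      have h5 := (abs_le.mp (h1.trans h4)).1
      have h6 := neg_abs_le (h' (y - f x₀))
      nlinarith [mul_pos hK hν]
    rw [sign_pos ht, sign_eq_one_iff]
    by_contra! hneg
    have hcs : ContinuousOn (fun s : ℝ => h (y + s • ν)) (Icc 0 K) := by
      refine hcont.comp (by fun_prop) fun s hs => ⟨(hpath s hs).1, (hpath s hs).2.1⟩
    obtain ⟨s, hs, hs0⟩ := intermediate_value_Icc hK.le hcs
      ⟨by simpa using hneg, hend.le⟩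
    exact (hpath s hs).2.2 hs0

/-- `h ∘ f` vanishes on the half-space near `x₀`, and a half-space determines derivatives even at
its boundary points. -/
theorem fderivWithin_apply_eq_zero (hf : IsHalfSpaceImmersion l L Z f x₀)
    (hu : UniqueDiffOn ℝ {x | 0 ≤ l x}) {h : E → ℝ}
    (hh : ContDiffWithinAt ℝ 1 h {y | 0 ≤ L y} (f x₀))
    (hZ : ∀ᶠ y in 𝓝 (f x₀), 0 ≤ L y → (h y = 0 ↔ y ∈ Z)) (x : F) :
    fderivWithin ℝ h {y | 0 ≤ L y} (f x₀) (fderiv ℝ f x₀ x) = 0 := by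
  have hO : ∀ᶠ x in 𝓝 x₀, 0 ≤ l x → 0 ≤ L (f x) ∧ h (f x) = 0 := by
    filter_upwards [hf.maps_nonneg, hf.mem, hf.contDiffAt.continuousAt.eventually hZ]
      with x h1 h2 h3 hx
    exact ⟨h1 hx, (h3 (h1 hx)).mpr (h2 hx)⟩
  set O : Set F := {x | 0 ≤ l x → 0 ≤ L (f x) ∧ h (f x) = 0}
  set D : Set F := {x | 0 ≤ l x}
  have hx₀ : x₀ ∈ D ∩ O := ⟨hf.nonneg, hO.self_of_nhds⟩
  have huniq : UniqueDiffWithinAt ℝ (D ∩ O) x₀ := (hu x₀ hf.nonneg).inter hO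
  have h1 : HasFDerivWithinAt (h ∘ f)
      ((fderivWithin ℝ h {y | 0 ≤ L y} (f x₀)).comp (fderiv ℝ f x₀)) (D ∩ O) x₀ :=
    (hh.differentiableWithinAt one_ne_zero).hasFDerivWithinAt.comp x₀
      (hf.contDiffAt.differentiableAt one_ne_zero).hasFDerivAt.hasFDerivWithinAt
      fun z hz => (hz.2 hz.1).1
  have h2 : HasFDerivWithinAt (h ∘ f) (0 : F →L[ℝ] ℝ) (D ∩ O) x₀ :=
    (hasFDerivWithinAt_const (0 : ℝ) x₀ (D ∩ O)).congr (fun z hz => (hz.2 hz.1).2)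
      (hx₀.2 hx₀.1).2
  exact congrArg (fun T : F →L[ℝ] ℝ => T x) (huniq.eq h1 h2)

variable [FiniteDimensional ℝ F]

theorem exists_notMem_range (hdim : Module.finrank ℝ E = Module.finrank ℝ F + 1)
    (A : F →L[ℝ] E) (L : E →L[ℝ] ℝ) : ∃ ν ∉ range A, 0 ≤ L ν := by
  obtain ⟨v, hv⟩ : ∃ v, v ∉ range A := by
    by_contra! hs
    have := LinearMap.finrank_le_finrank_of_surjective (f := A.toLinearMap) hs
    omega
  rcases le_total 0 (L v) with h | h
  · exact ⟨v, hv, h⟩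
  · exact ⟨-v, fun ⟨x, hx⟩ => hv ⟨-x, by rw [map_neg, hx, neg_neg]⟩, by rw [map_neg]; linarith⟩

variable [FiniteDimensional ℝ E]

theorem exists_eq_add_smul (hdim : Module.finrank ℝ E = Module.finrank ℝ F + 1)
    {A : F →L[ℝ] E} (hA : Function.Injective A) {ν : E} (hν : ν ∉ range A) (v : E) :
    ∃ x : F, ∃ c : ℝ, v = A x + c • ν := by
  let T : F × ℝ →ₗ[ℝ] E := A.toLinearMap.coprod (LinearMap.toSpanSingleton ℝ E ν)
  have hT : ∀ p, T p = A p.1 + p.2 • ν := fun p => by simp [T]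
  have hinj : Function.Injective T := by
    rw [injective_iff_map_eq_zero]
    rintro ⟨x, t⟩ h
    exact eq_zero_of_apply_add_smul_eq_zero hA hν (by rwa [hT] at h)
  obtain ⟨⟨x, c⟩, h⟩ := (LinearMap.injective_iff_surjective_of_finrank_eq_finrank
    (by simp [hdim])).mp hinj v
  exact ⟨x, c, by rw [← h, hT]⟩

/-- Two functions with zero set `Z` near `f x₀` whose derivatives are positive on a common vector
have the same signs near `f x₀`. -/
theorem eventually_sign_eq (hf : IsHalfSpaceImmersion l L Z f x₀)
    (hdim : Module.finrank ℝ E = Module.finrank ℝ F + 1)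
    (hu : UniqueDiffOn ℝ {y | 0 ≤ L y}) (hul : UniqueDiffOn ℝ {x | 0 ≤ l x}) {h₁ h₂ : E → ℝ}
    (hh₁ : ContDiffWithinAt ℝ 1 h₁ {y | 0 ≤ L y} (f x₀))
    (hh₂ : ContDiffWithinAt ℝ 1 h₂ {y | 0 ≤ L y} (f x₀))
    (hZ₁ : ∀ᶠ y in 𝓝 (f x₀), 0 ≤ L y → (h₁ y = 0 ↔ y ∈ Z))
    (hZ₂ : ∀ᶠ y in 𝓝 (f x₀), 0 ≤ L y → (h₂ y = 0 ↔ y ∈ Z)) {v : E}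
    (hv₁ : 0 < fderivWithin ℝ h₁ {y | 0 ≤ L y} (f x₀) v)
    (hv₂ : 0 < fderivWithin ℝ h₂ {y | 0 ≤ L y} (f x₀) v) :
    ∀ᶠ y in 𝓝 (f x₀), 0 ≤ L y → SignType.sign (h₁ y) = SignType.sign (h₂ y) := by
  obtain ⟨ν, hν, hLν⟩ := exists_notMem_range hdim (fderiv ℝ f x₀) L
  obtain ⟨τ, hτd, hτ, hτ'⟩ := exists_transversal_coordinate hdim hf.contDiffAt hf.injective hν
  obtain ⟨x, c, rfl⟩ := exists_eq_add_smul hdim hf.injective hν v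
  rw [map_add, map_smul, hf.fderivWithin_apply_eq_zero hul hh₁ hZ₁, zero_add, smul_eq_mul] at hv₁
  rw [map_add, map_smul, hf.fderivWithin_apply_eq_zero hul hh₂ hZ₂, zero_add, smul_eq_mul] at hv₂
  rcases lt_trichotomy c 0 with hc | hc | hc
  -- The orientation of `ν` is tied to `0 ≤ L ν`, so for `c < 0` the functions change sign instead.
  · have key : ∀ h : E → ℝ, ContDiffWithinAt ℝ 1 h {y | 0 ≤ L y} (f x₀) →
        (∀ᶠ y in 𝓝 (f x₀), 0 ≤ L y → (h y = 0 ↔ y ∈ Z)) →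
        0 < c * fderivWithin ℝ h {y | 0 ≤ L y} (f x₀) ν →
        ∀ᶠ y in 𝓝 (f x₀), 0 ≤ L y → SignType.sign (-h y) = SignType.sign (τ y) := by
      intro h hh hZ hpos
      refine hf.eventually_sign_eq_coordinate hu hLν hτd.continuousAt hτ hτ' hh.neg
        (hZ.mono fun y hy hLy => by rw [neg_eq_zero]; exact hy hLy) ?_
      rw [fderivWithin_fun_neg (hu _ (hf.maps_nonneg.self_of_nhds hf.nonneg)), neg_apply]
      nlinarith
    filter_upwards [key h₁ hh₁ hZ₁ hv₁, key h₂ hh₂ hZ₂ hv₂] with y hy₁ hy₂ hLy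
    have := (hy₁ hLy).trans (hy₂ hLy).symm
    rwa [Left.sign_neg, Left.sign_neg, neg_inj] at this
  · simp [hc] at hv₁
  · filter_upwards [hf.eventually_sign_eq_coordinate hu hLν hτd.continuousAt hτ hτ' hh₁ hZ₁
        (pos_of_mul_pos_right hv₁ hc.le),
      hf.eventually_sign_eq_coordinate hu hLν hτd.continuousAt hτ hτ' hh₂ hZ₂
        (pos_of_mul_pos_right hv₂ hc.le)] with y hy₁ hy₂ hLy
    exact (hy₁ hLy).trans (hy₂ hLy).symm

/-- A `C¹` function with zero set `Z` near `f x₀` and derivative nonzero on a given transversal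
vector. -/
theorem exists_defining_function (hf : IsHalfSpaceImmersion l L Z f x₀)
    (hdim : Module.finrank ℝ E = Module.finrank ℝ F + 1) {v : E}
    (hv : v ∉ range (fderiv ℝ f x₀)) :
    ∃ τ : E → ℝ, ContDiffAt ℝ 1 τ (f x₀) ∧ (∀ᶠ y in 𝓝 (f x₀), 0 ≤ L y → (τ y = 0 ↔ y ∈ Z)) ∧
      0 < fderiv ℝ τ (f x₀) v := by
  obtain ⟨τ, hτd, hτ, hτ'⟩ := exists_transversal_coordinate hdim hf.contDiffAt hf.injective hv
  refine ⟨τ, hτd, hf.eventually_eq_zero_iff hτ hτ', ?_⟩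
  have h1 : HasFDerivAt (fun t : ℝ => f x₀ + t • v)
      ((ContinuousLinearMap.id ℝ ℝ).smulRight v) (0 : ℝ) :=
    ((hasFDerivAt_id (𝕜 := ℝ) (0 : ℝ)).smul_const v).const_add (f x₀)
  have h2 : HasFDerivAt τ (fderiv ℝ τ (f x₀)) (f x₀ + (0 : ℝ) • v) := by
    rw [zero_smul, add_zero]
    exact (hτd.differentiableAt one_ne_zero).hasFDerivAt
  have h3 := HasFDerivAt.comp (0 : ℝ) h2 h1
  have h4 : HasFDerivAt (τ ∘ fun t : ℝ => f x₀ + t • v) (ContinuousLinearMap.id ℝ ℝ) (0 : ℝ) := by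
    refine (hasFDerivAt_id (𝕜 := ℝ) (0 : ℝ)).congr_of_eventuallyEq ?_
    have : Tendsto (fun t : ℝ => (x₀, t)) (𝓝 0) (𝓝 (x₀, 0)) :=
      (Continuous.prodMk_right x₀).tendsto 0
    filter_upwards [this.eventually hτ] with t ht
    exact ht
  have h5 := congrArg (fun T : ℝ →L[ℝ] ℝ => T 1) (h3.unique h4)
  simp only [ContinuousLinearMap.comp_apply, ContinuousLinearMap.smulRight_apply,
    ContinuousLinearMap.id_apply, one_smul] at h5
  rw [h5]
  exact one_pos

end IsHalfSpaceImmersion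
end

/-! ### Charts and side functions on the manifold -/

theorem frontier_setOf_continuousLinearMap_nonneg {F : Type*} [NormedAddCommGroup F] [NormedSpace ℝ F] {l : F →L[ℝ] ℝ}
    (hl : l ≠ 0) : frontier {x | 0 ≤ l x} = {x | l x = 0} := by
  have hsurj : Function.Surjective l :=
    LinearMap.surjective (f := l.toLinearMap) fun h => hl (ContinuousLinearMap.coe_injective h)
  have hopen : IsOpenMap l := l.isOpenMap_of_ne_zero hl
  have h := hopen.preimage_frontier_eq_frontier_preimage l.continuous (Ici (0 : ℝ))
  rw [frontier_Ici] at h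
  exact h.symm

section

variable {E : Type*} [NormedAddCommGroup E] [NormedSpace ℝ E]
  {H : Type*} [TopologicalSpace H] {I : ModelWithCorners ℝ E H}
  {M : Type*} [TopologicalSpace M] [ChartedSpace H M]
  {F : Type*} [NormedAddCommGroup F] [NormedSpace ℝ F]
  {G : Type*} [TopologicalSpace G] {J : ModelWithCorners ℝ F G}
  {S : Type*} [TopologicalSpace S] [ChartedSpace G S]

/-- Boundary points are defined by the preferred chart at `x`; smoothness makes the notion
independent of the chart. -/
theorem ModelWithCorners.isBoundaryPoint_iff_extChartAt_mem_frontier [IsManifold I ∞ M] {x p : M}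
    (hx : x ∈ (extChartAt I p).source) :
    I.IsBoundaryPoint x ↔ extChartAt I p x ∈ frontier (range I) := by
  have hxs : x ∈ (chartAt H p).source := by rwa [extChartAt_source] at hx
  rw [← not_iff_not, ← I.isInteriorPoint_iff_not_isBoundaryPoint,
    I.isInteriorPoint_iff_of_mem_atlas (n := ∞) (by simp) (chart_mem_atlas H p) hxs,
    ← mem_interior_iff_notMem_frontier (by rw [extChartAt_coe]; exact mem_range_self _)]
  exact ⟨fun h => (chartAt H p).interior_extend_target_subset_interior_range h,
    fun h => (chartAt H p).mem_interior_extend_target ((chartAt H p).map_source hxs) h⟩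

/-- The image of a subset `Z` of the manifold in the chart at `p`. -/
def chartImage (I : ModelWithCorners ℝ E H) (Z : Set M) (p : M) : Set E :=
  {y | y ∈ range I ∧ (extChartAt I p).symm y ∈ Z}

/-- The chart expression of `f` is extended by reflection, for which `mapsTo_boundary` is needed.
That `f` is a topological embedding excludes other sheets of the image near `f s₀`, which gives
`exists_eq`. -/
theorem IsProperEmbedding.exists_isHalfSpaceImmersion [IsManifold I ∞ M] [IsManifold J ∞ S]
    {f : S → M} (hf : IsProperEmbedding I J f) {L : E →L[ℝ] ℝ} (hL : range I = {x | 0 ≤ L x})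
    {l : F →L[ℝ] ℝ} (hl : range J = {x | 0 ≤ l x}) (s₀ : S) :
    ∃ f₁ : F → E, IsHalfSpaceImmersion l L (chartImage I (range f) (f s₀)) f₁ (extChartAt J s₀ s₀) ∧
      f₁ (extChartAt J s₀ s₀) = extChartAt I (f s₀) (f s₀) ∧
      ∀ v : F, fderiv ℝ f₁ (extChartAt J s₀ s₀) v = mfderiv J I f s₀ v := by
  set φ := extChartAt J s₀ with hφ
  set ψ := extChartAt I (f s₀) with hψ
  have hfs : ContMDiffAt J I ∞ f s₀ := hf.contMDiff s₀
  obtain ⟨hcont, hdiff⟩ := contMDiffAt_iff.mp hfs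
  set F₀ : F → E := ψ ∘ f ∘ φ.symm with hF₀
  have hrJ : ∀ {x}, x ∈ range J ↔ 0 ≤ l x := fun {x} => by rw [hl]; rfl
  have hrI : ∀ {x}, x ∈ range I ↔ 0 ≤ L x := fun {x} => by rw [hL]; rfl
  have hψI : ∀ z, ψ z ∈ range I := fun z => by
    rw [hψ, extChartAt_coe]; exact mem_range_self _
  have hφJ : ∀ z, φ z ∈ range J := fun z => by
    rw [hφ, extChartAt_coe]; exact mem_range_self _
  have hφ₀ : φ.symm (φ s₀) = s₀ := extChartAt_to_inv s₀
  have htgt : ∀ᶠ x in 𝓝 (φ s₀), x ∈ range J → x ∈ φ.target :=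
    eventually_nhdsWithin_iff.mp (extChartAt_target_mem_nhdsWithin s₀)
  have hsymm : Tendsto φ.symm (𝓝 (φ s₀)) (𝓝 s₀) := by
    have := continuousAt_extChartAt_symm (I := J) s₀
    rwa [ContinuousAt, extChartAt_to_inv] at this
  have hsrc : ∀ᶠ x in 𝓝 (φ s₀), f (φ.symm x) ∈ ψ.source :=
    hsymm.eventually (hcont.eventually (extChartAt_source_mem_nhds (I := I) (f s₀)))
  have hdiff1 : ContDiffWithinAt ℝ 1 F₀ {x | 0 ≤ l x} (φ s₀) := by
    rw [← hl]; exact hdiff.of_le (by simp)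
  obtain ⟨f₁, hf₁, hf₁eq, hf₁neg⟩ := exists_contDiffAt_extension (L := L) (hrJ.mp (hφJ s₀)) hdiff1
    (Eventually.of_forall fun x _ => hrI.mp (hψI _)) (by
      intro hl0 hlx
      have hs₀ : s₀ ∈ J.boundary S := by
        change φ s₀ ∈ frontier (range J)
        rw [hl, frontier_setOf_continuousLinearMap_nonneg hl0]
        exact hlx
      have hL0 : L ≠ 0 := by
        rintro rfl
        have h1 : extChartAt I (f s₀) (f s₀) ∈ frontier (range I) := hf.mapsTo_boundary hs₀
        simp [hL] at h1
      refine ⟨hL0, ?_⟩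
      filter_upwards [htgt, hsrc] with x hx hxs hlx0
      have hxt := hx (hrJ.mpr hlx0.ge)
      have h1 : φ.symm x ∈ J.boundary S := by
        refine (J.isBoundaryPoint_iff_extChartAt_mem_frontier (φ.map_target hxt)).mpr ?_
        change φ (φ.symm x) ∈ frontier (range J)
        rw [φ.right_inv hxt, hl, frontier_setOf_continuousLinearMap_nonneg hl0]
        exact hlx0
      have h2 := (I.isBoundaryPoint_iff_extChartAt_mem_frontier hxs).mp (hf.mapsTo_boundary h1)
      change F₀ x ∈ frontier (range I) at h2
      rwa [hL, frontier_setOf_continuousLinearMap_nonneg hL0] at h2)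
  have hval : f₁ (φ s₀) = ψ (f s₀) := by
    rw [hf₁eq _ (hrJ.mp (hφJ s₀)), hF₀]
    simp only [Function.comp_apply, hφ₀]
  have hder : ∀ v : F, fderiv ℝ f₁ (φ s₀) v = mfderiv J I f s₀ v := by
    intro v
    have h1 : mfderiv J I f s₀ = fderivWithin ℝ F₀ (range J) (φ s₀) :=
      (hfs.mdifferentiableAt (by simp)).mfderiv
    rw [h1, ← fderivWithin_eq_fderiv (J.uniqueDiffOn _ (hφJ s₀)) (hf₁.differentiableAt one_ne_zero),
      fderivWithin_congr (fun x hx => hf₁eq x (hrJ.mp hx)) (hf₁eq _ (hrJ.mp (hφJ s₀)))]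
    rfl
  refine ⟨f₁, ⟨hrJ.mp (hφJ s₀), hf₁, ?_, ?_, hf₁neg, ?_, ?_⟩, hval, hder⟩
  · intro v w hvw
    rw [hder, hder] at hvw
    exact hf.injective_mfderiv s₀ hvw
  · exact Eventually.of_forall fun x hx => by rw [hf₁eq x hx]; exact hrI.mp (hψI _)
  · filter_upwards [hsrc] with x hx hlx
    rw [hf₁eq x hlx]
    refine ⟨hψI _, ?_⟩
    change ψ.symm (ψ (f (φ.symm x))) ∈ range f
    rw [ψ.left_inv hx]
    exact mem_range_self _
  · intro O hO
    rw [hval]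
    have hV : {s | s ∈ φ.source ∧ φ s ∈ O} ∈ 𝓝 s₀ :=
      inter_mem (extChartAt_source_mem_nhds s₀) ((continuousAt_extChartAt s₀) hO)
    rw [hf.isEmbedding.nhds_eq_comap, mem_comap] at hV
    obtain ⟨U, hU, hUV⟩ := hV
    have hsymmI : Tendsto ψ.symm (𝓝 (ψ (f s₀))) (𝓝 (f s₀)) := by
      have := continuousAt_extChartAt_symm (I := I) (f s₀)
      rwa [ContinuousAt, extChartAt_to_inv] at this
    have htgtI : ∀ᶠ x in 𝓝 (ψ (f s₀)), x ∈ range I → x ∈ ψ.target :=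
      eventually_nhdsWithin_iff.mp (extChartAt_target_mem_nhdsWithin (f s₀))
    filter_upwards [hsymmI hU, htgtI] with y hyU hyt hyZ
    obtain ⟨s, hs⟩ := hyZ.2
    have hsV := hUV (show f s ∈ U by rw [hs]; exact hyU)
    refine ⟨φ s, hsV.2, hrJ.mp (hφJ s), ?_⟩
    rw [hf₁eq _ (hrJ.mp (hφJ s))]
    change ψ (f (φ.symm (φ s))) = y
    rw [φ.left_inv hsV.1, hs]
    exact ψ.right_inv (hyt hyZ.1)

/-- `θ` is a `C¹` function near `q` whose zero set near `q` is `Z` and which increases in the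
direction of `N q`. -/
structure IsSideFunctionAt (I : ModelWithCorners ℝ E H) (Z : Set M) (N : ∀ p : M, TangentSpace I p)
    (θ : M → ℝ) (q : M) : Prop where
  contMDiffAt : ContMDiffAt I 𝓘(ℝ, ℝ) 1 θ q
  zero_iff : ∀ᶠ y in 𝓝 q, θ y = 0 ↔ y ∈ Z
  pos : (0 : ℝ) < mfderiv I 𝓘(ℝ, ℝ) θ q (N q)

namespace IsSideFunctionAt

variable {Z : Set M} {N : ∀ p : M, TangentSpace I p} {θ : M → ℝ} {q : M}

theorem contDiffWithinAt (h : IsSideFunctionAt I Z N θ q) :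
    ContDiffWithinAt ℝ 1 (θ ∘ (extChartAt I q).symm) (range I) (extChartAt I q q) :=
  contMDiffWithinAt_iff_contDiffWithinAt.mp (contMDiffAt_iff_source.mp h.contMDiffAt)

theorem eventually_zero_iff (h : IsSideFunctionAt I Z N θ q) :
    ∀ᶠ y in 𝓝 (extChartAt I q q), y ∈ range I →
      ((θ ∘ (extChartAt I q).symm) y = 0 ↔ y ∈ chartImage I Z q) := by
  have hsymm : Tendsto (extChartAt I q).symm (𝓝 (extChartAt I q q)) (𝓝 q) := by
    have := continuousAt_extChartAt_symm (I := I) q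
    rwa [ContinuousAt, extChartAt_to_inv] at this
  filter_upwards [hsymm.eventually h.zero_iff] with y hy hyI
  exact hy.trans ⟨fun hz => ⟨hyI, hz⟩, fun hz => hz.2⟩

end IsSideFunctionAt

theorem mfderiv_eq_fderivWithin_comp_extChartAt_symm {θ : M → ℝ} {q : M}
    (h : MDifferentiableAt I 𝓘(ℝ, ℝ) θ q) (v : E) :
    mfderiv I 𝓘(ℝ, ℝ) θ q v =
      fderivWithin ℝ (θ ∘ (extChartAt I q).symm) (range I) (extChartAt I q q) v := by
  rw [h.mfderiv]; rfl

theorem IsProperEmbedding.mfderiv_apply_eq_zero [IsManifold I ∞ M] [IsManifold J ∞ S]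
    (hI : IsBoundaryModel I) (hJ : IsBoundaryModel J)
    {f : S → M} (hf : IsProperEmbedding I J f) {N : ∀ p : M, TangentSpace I p} {θ : M → ℝ} {q : M}
    (hθ : IsSideFunctionAt I (range f) N θ q) {v : TangentSpace I q}
    (hv : v ∈ tangentToImage I J f q) : mfderiv I 𝓘(ℝ, ℝ) θ q v = (0 : ℝ) := by
  obtain ⟨L, hL⟩ := hI
  obtain ⟨l, hl⟩ := hJ
  obtain ⟨W, hW⟩ := hv
  -- `hW` equates points of the tangent bundle, so base point and vector must be generalized
  -- together before substituting.
  have key : ∀ X : TangentBundle I M, tangentMap J I f W = X →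
      IsSideFunctionAt I (range f) N θ X.proj → mfderiv I 𝓘(ℝ, ℝ) θ X.proj X.snd = (0 : ℝ) := by
    rintro _ rfl hθ
    obtain ⟨f₁, hf₁, hval, hder⟩ := hf.exists_isHalfSpaceImmersion hL hl W.proj
    have h1 := hf₁.fderivWithin_apply_eq_zero (hl ▸ J.uniqueDiffOn)
      (h := θ ∘ (extChartAt I (f W.proj)).symm)
      (by rw [hval, ← hL]; exact hθ.contDiffWithinAt)
      (by
        rw [hval]
        filter_upwards [hθ.eventually_zero_iff] with y hy hLy
        exact hy (by rw [hL]; exact hLy)) W.snd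
    rw [hval, ← hL] at h1
    have h2 : mfderiv I 𝓘(ℝ, ℝ) θ (f W.proj) (mfderiv J I f W.proj W.snd) = (0 : ℝ) :=
      (mfderiv_eq_fderivWithin_comp_extChartAt_symm
        (hθ.contMDiffAt.mdifferentiableAt one_ne_zero) _).trans
        ((congrArg _ (hder W.snd).symm).trans h1)
    exact h2
  exact key ⟨q, v⟩ hW hθ

theorem IsProperEmbedding.eventually_sign_eq [IsManifold I ∞ M] [IsManifold J ∞ S]
    [FiniteDimensional ℝ E] [FiniteDimensional ℝ F]
    (hdim : Module.finrank ℝ E = Module.finrank ℝ F + 1)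
    (hI : IsBoundaryModel I) (hJ : IsBoundaryModel J)
    {f : S → M} (hf : IsProperEmbedding I J f) {N : ∀ p : M, TangentSpace I p} {θ₁ θ₂ : M → ℝ}
    {q : M} (hq : q ∈ range f)
    (hθ₁ : IsSideFunctionAt I (range f) N θ₁ q) (hθ₂ : IsSideFunctionAt I (range f) N θ₂ q) :
    ∀ᶠ y in 𝓝 q, SignType.sign (θ₁ y) = SignType.sign (θ₂ y) := by
  obtain ⟨L, hL⟩ := hI
  obtain ⟨l, hl⟩ := hJ
  obtain ⟨s, rfl⟩ := hq
  obtain ⟨f₁, hf₁, hval, hder⟩ := hf.exists_isHalfSpaceImmersion hL hl s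
  have hprop : ∀ {θ : M → ℝ}, IsSideFunctionAt I (range f) N θ (f s) →
      ContDiffWithinAt ℝ 1 (θ ∘ (extChartAt I (f s)).symm) {y | 0 ≤ L y}
        (f₁ (extChartAt J s s)) ∧
      (∀ᶠ y in 𝓝 (f₁ (extChartAt J s s)), 0 ≤ L y →
        ((θ ∘ (extChartAt I (f s)).symm) y = 0 ↔ y ∈ chartImage I (range f) (f s))) ∧
      0 < fderivWithin ℝ (θ ∘ (extChartAt I (f s)).symm) {y | 0 ≤ L y}
        (f₁ (extChartAt J s s)) (N (f s)) := by
    intro θ hθ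
    rw [hval, ← hL]
    refine ⟨hθ.contDiffWithinAt, ?_, ?_⟩
    · filter_upwards [hθ.eventually_zero_iff] with y hy hLy
      exact hy (by rw [hL]; exact hLy)
    · exact hθ.pos.trans_eq (mfderiv_eq_fderivWithin_comp_extChartAt_symm
        (hθ.contMDiffAt.mdifferentiableAt one_ne_zero) _)
  obtain ⟨h1, h2, h3⟩ := hprop hθ₁
  obtain ⟨h4, h5, h6⟩ := hprop hθ₂
  have h := hf₁.eventually_sign_eq hdim (hL ▸ I.uniqueDiffOn) (hl ▸ J.uniqueDiffOn) h1 h4 h2 h5 h3 h6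
  rw [hval] at h
  filter_upwards [(continuousAt_extChartAt (I := I) (f s)).eventually h,
    extChartAt_source_mem_nhds (I := I) (f s)] with z hz hzs
  have hzI : extChartAt I (f s) z ∈ {y | 0 ≤ L y} := by
    rw [← hL, extChartAt_coe]; exact mem_range_self _
  have := hz hzI
  simp only [Function.comp_apply] at this
  rwa [(extChartAt I (f s)).left_inv hzs] at this

/-- Positivity of `dθ(N)` persists along `Z` because the tangent map of `θ` and the field `N` are
continuous; this is how two-sidedness enters. -/
theorem IsSideFunctionAt.eventually [IsManifold I ∞ M] {Z : Set M} {N : ∀ p : M, TangentSpace I p}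
    (hN : ContinuousOn (fun p => (⟨p, N p⟩ : TangentBundle I M)) Z)
    {θ : M → ℝ} {p : M} (hp : p ∈ Z) (hθ : IsSideFunctionAt I Z N θ p) :
    ∀ᶠ q in 𝓝 p, ContinuousAt θ q ∧ (q ∈ Z → IsSideFunctionAt I Z N θ q) := by
  have h1 : ∀ᶠ q in 𝓝 p, ContMDiffAt I 𝓘(ℝ, ℝ) 1 θ q := 
    (contMDiffAt_iff_contMDiffAt_nhds (by simp)).mp hθ.contMDiffAt
  obtain ⟨U, hU, hUo, hpU⟩ := mem_nhds_iff.mp h1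
  have hon : ContMDiffOn I 𝓘(ℝ, ℝ) 1 θ U := fun q hq => (hU hq).contMDiffWithinAt
  have hT := hon.continuousOn_tangentMapWithin le_rfl hUo.uniqueMDiffOn
  have hc : ContinuousOn (fun q => tangentMapWithin I 𝓘(ℝ, ℝ) θ U ⟨q, N q⟩) (Z ∩ U) :=
    hT.comp (hN.mono inter_subset_left) fun q hq => hq.2
  have hc2 : ContinuousOn (fun q => (mfderiv I 𝓘(ℝ, ℝ) θ q (N q) : ℝ)) (Z ∩ U) := by
    have h3 := (continuous_snd.comp
      (tangentBundleModelSpaceHomeomorph 𝓘(ℝ, ℝ)).continuous).comp_continuousOn hc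
    refine h3.congr fun q hq => ?_
    exact congrArg (fun T : TangentSpace I q →L[ℝ] TangentSpace 𝓘(ℝ, ℝ) (θ q) => T (N q))
      (mfderivWithin_of_isOpen hUo hq.2).symm
  have h4 : ∀ᶠ q in 𝓝[Z ∩ U] p, (0 : ℝ) < mfderiv I 𝓘(ℝ, ℝ) θ q (N q) :=
    (hc2 p ⟨hp, hpU⟩).eventually (lt_mem_nhds hθ.pos)
  have h5 := eventually_nhdsWithin_iff.mp h4
  filter_upwards [h1, h5, hθ.zero_iff.eventually_nhds, hUo.mem_nhds hpU] with q hq1 hq2 hq3 hq4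
  exact ⟨hq1.continuousAt, fun hqZ => ⟨hq1, hq3, hq2 ⟨hqZ, hq4⟩⟩⟩

/-- A unit normal vector is not tangent, so the coordinate transversal to the hypersurface in the
direction `N` serves. -/
theorem IsProperEmbedding.exists_isSideFunctionAt [IsManifold I ∞ M] [IsManifold J ∞ S]
    [FiniteDimensional ℝ E] [FiniteDimensional ℝ F]
    (hdim : Module.finrank ℝ E = Module.finrank ℝ F + 1)
    (hI : IsBoundaryModel I) (hJ : IsBoundaryModel J)
    {f : S → M} (hf : IsProperEmbedding I J f)
    {g : Bundle.ContMDiffRiemannianMetric I ∞ E (fun p : M ↦ TangentSpace I p)}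
    {N : ∀ p : M, TangentSpace I p} (hN : IsUnitNormalField I J g f N) {p : M} (hp : p ∈ range f) :
    ∃ θ : M → ℝ, IsSideFunctionAt I (range f) N θ p := by
  obtain ⟨L, hL⟩ := hI
  obtain ⟨l, hl⟩ := hJ
  obtain ⟨s, rfl⟩ := hp
  obtain ⟨f₁, hf₁, hval, hder⟩ := hf.exists_isHalfSpaceImmersion hL hl s
  have hNr : N (f s) ∉ range (fderiv ℝ f₁ (extChartAt J s s)) := by
    rintro ⟨v, hv⟩
    have h1 : N (f s) ∈ tangentToImage I J f (f s) := ⟨⟨s, v⟩, by rw [← hv, hder]; rfl⟩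
    have h2 := hN.normal _ ⟨s, rfl⟩ _ h1
    rw [hN.unit _ ⟨s, rfl⟩] at h2
    exact one_ne_zero h2
  obtain ⟨τ, hτ, hτZ, hτN⟩ := hf₁.exists_defining_function hdim hNr
  rw [hval] at hτ hτZ hτN
  have hψI : ∀ z, extChartAt I (f s) z ∈ range I := fun z => by
    rw [extChartAt_coe]; exact mem_range_self _
  have hC : ContMDiffAt I 𝓘(ℝ, ℝ) 1 (τ ∘ extChartAt I (f s)) (f s) :=
    hτ.contMDiffAt.comp (f s) contMDiffAt_extChartAt
  refine ⟨τ ∘ extChartAt I (f s), hC, ?_, ?_⟩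
  · filter_upwards [(continuousAt_extChartAt (I := I) (f s)).eventually hτZ,
      extChartAt_source_mem_nhds (I := I) (f s)] with z hz hzs
    have hzI : extChartAt I (f s) z ∈ {y | 0 ≤ L y} := by rw [← hL]; exact hψI z
    refine (hz hzI).trans ?_
    simp only [chartImage, mem_ofPred_eq, (extChartAt I (f s)).left_inv hzs]
    exact and_iff_right (hψI z)
  · have h1 : (τ ∘ extChartAt I (f s)) ∘ (extChartAt I (f s)).symm
        =ᶠ[𝓝[range I] (extChartAt I (f s) (f s))] τ := by
      filter_upwards [extChartAt_target_mem_nhdsWithin (I := I) (f s)] with y hy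
      simp only [Function.comp_apply, (extChartAt I (f s)).right_inv hy]
    refine hτN.trans_eq ?_
    refine Eq.symm ((mfderiv_eq_fderivWithin_comp_extChartAt_symm
      (hC.mdifferentiableAt one_ne_zero) _).trans ?_)
    rw [h1.fderivWithin_eq (by simp), fderivWithin_eq_fderiv (I.uniqueDiffOn _ (hψI _))
      (hτ.differentiableAt one_ne_zero)]

end

/-! ### Sign changes at zeros of a real function -/

theorem eventually_lt_and_gt_of_hasDerivAt_pos {h : ℝ → ℝ} {h' t : ℝ} (hd : HasDerivAt h h' t)
    (h0 : h t = 0) (hpos : 0 < h') : (∀ᶠ s in 𝓝[<] t, h s < 0) ∧ ∀ᶠ s in 𝓝[>] t, 0 < h s := by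
  have hs := hasDerivAt_iff_tendsto_slope.mp hd
  have hev := hs.eventually (lt_mem_nhds hpos)
  rw [eventually_nhdsWithin_iff] at hev
  constructor
  · filter_upwards [mem_nhdsWithin_of_mem_nhds hev, self_mem_nhdsWithin] with s hs1 hs2
    have := hs1 (ne_of_lt hs2)
    rw [slope_def_field, h0, sub_zero] at this
    have hst : s - t < 0 := sub_neg.mpr hs2
    by_contra! hc
    exact this.not_ge (div_nonpos_of_nonneg_of_nonpos hc hst.le)
  · filter_upwards [mem_nhdsWithin_of_mem_nhds hev, self_mem_nhdsWithin] with s hs1 hs2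
    have := hs1 (ne_of_gt hs2)
    rw [slope_def_field, h0, sub_zero] at this
    have hst : 0 < s - t := sub_pos.mpr hs2
    by_contra! hc
    exact this.not_ge (div_nonpos_of_nonpos_of_nonneg hc hst.le)

/-- If a continuous function on `[0,1]` has, at each of two consecutive zeros in `(0,1)`, the sign
change prescribed by the sign of `a`, then `a` takes values of opposite signs at these zeros. -/
theorem mul_neg_of_consecutive_zeros {h a : ℝ → ℝ} (hc : ContinuousOn h (Icc 0 1)) {s t : ℝ}
    (hs : s ∈ Icc (0 : ℝ) 1) (ht : t ∈ Icc (0 : ℝ) 1) (hst : s < t)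
    (hne : ∀ r ∈ Ioo s t, h r ≠ 0)
    (hs0 : a s ≠ 0) (ht0 : a t ≠ 0)
    (hs1 : ∀ᶠ r in 𝓝[>] s, 0 < a s * h r) (ht1 : ∀ᶠ r in 𝓝[<] t, a t * h r < 0) :
    a s * a t < 0 := by
  by_contra! hcon
  have hpos : 0 < a s * a t := lt_of_le_of_ne hcon (mul_ne_zero hs0 ht0).symm
  obtain ⟨u, hu, hu1⟩ := (Filter.Eventually.and (Ioo_mem_nhdsGT hst) hs1).exists
  obtain ⟨v, hv, hv1⟩ := (Filter.Eventually.and (Ioo_mem_nhdsLT hst) ht1).exists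
  have hsub : uIcc u v ⊆ Ioo s t := (ordConnected_Ioo).uIcc_subset hu hv
  have hcuv : ContinuousOn (fun r => a s * h r) (uIcc u v) :=
    (continuousOn_const.mul hc).mono fun r hr =>
      ⟨hs.1.trans (hsub hr).1.le, (hsub hr).2.le.trans ht.2⟩
  have hv2 : a s * h v < 0 := by
    have h1 : 0 < a t * a t := mul_self_pos.mpr ht0
    have h2 : (a s * a t) * (a t * h v) < 0 := mul_neg_of_pos_of_neg hpos hv1
    by_contra! h3
    nlinarith [mul_nonneg h1.le h3]
  obtain ⟨r, hr, hr0⟩ := intermediate_value_uIcc hcuv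
    (mem_uIcc.mpr (Or.inr ⟨hv2.le, hu1.le⟩))
  rcases mul_eq_zero.mp hr0 with h | h
  · exact hs0 h
  · exact hne r (hsub hr) h

/-! ### The global side function and its crossings -/

section

variable {E : Type*} [NormedAddCommGroup E] [NormedSpace ℝ E]
  {H : Type*} [TopologicalSpace H] {I : ModelWithCorners ℝ E H}
  {M : Type*} [TopologicalSpace M] [ChartedSpace H M]
  {F : Type*} [NormedAddCommGroup F] [NormedSpace ℝ F]
  {G : Type*} [TopologicalSpace G] {J : ModelWithCorners ℝ F G}
  {S : Type*} [TopologicalSpace S] [ChartedSpace G S]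

/-- A global function with zero set the hypersurface and with the signs of its side functions. -/
theorem IsProperEmbedding.exists_global_side_function [IsManifold I ∞ M] [IsManifold J ∞ S]
    [FiniteDimensional ℝ E] [FiniteDimensional ℝ F]
    [T2Space M] [SecondCountableTopology M] [ConnectedSpace M] [ConnectedSpace S]
    (hdim : Module.finrank ℝ E = Module.finrank ℝ F + 1)
    (hI : IsBoundaryModel I) (hJ : IsBoundaryModel J)
    (x₀ : M) [Finite (FundamentalGroup M x₀)]
    {f : S → M} (hf : IsProperEmbedding I J f)
    {g : Bundle.ContMDiffRiemannianMetric I ∞ E (fun p : M ↦ TangentSpace I p)}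
    {N : ∀ p : M, TangentSpace I p} (hN : IsUnitNormalField I J g f N) :
    ∃ κ : C(M, ℝ), (∀ y, κ y = 0 ↔ y ∈ range f) ∧
      ∀ q ∈ range f, ∀ θ, IsSideFunctionAt I (range f) N θ q →
        ∀ᶠ y in 𝓝 q, SignType.sign (κ y) = SignType.sign (θ y) := by
  have : LocallyCompactSpace M := Manifold.locallyCompact_of_finiteDimensional I
  -- Lifting requires local path connectedness, which `M` inherits from the convex half-space.
  have hH : LocallyPathConnectedSpace H := by
    have h1 : LocallyPathConnectedSpace (range I) := by
      obtain ⟨L, hL⟩ := hI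
      rw [hL]
      exact (convex_halfSpace_ge L.isLinear 0).locallyPathConnectedSpace
    have h2 : Topology.IsQuotientMap ((I.isClosedEmbedding.isEmbedding.toHomeomorph).symm) :=
      Homeomorph.isQuotientMap _
    exact h2.locallyPathConnectedSpace
  have : LocallyPathConnectedSpace M := ChartedSpace.locallyPathConnectedSpace H M
  have : PathConnectedSpace M := .of_locallyPathConnectedSpace
  have hclosed : IsClosed (range f) := hf.isProperMap.isClosed_range
  have hconn : IsConnected (range f) := isConnected_range hf.contMDiff.continuous
  obtain ⟨k, hk⟩ := exists_continuous_sign_eq hclosed (IsSideFunctionAt I (range f) N)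
    (fun p hp => by
      obtain ⟨θ, hθ⟩ := hf.exists_isSideFunctionAt hdim hI hJ hN hp
      exact ⟨θ, hθ.eventually hN.continuousOn hp⟩)
    (fun q hq θ θ' hθ hθ' => hf.eventually_sign_eq hdim hI hJ hq hθ hθ')
  obtain ⟨κ, hκ0, hκ⟩ := exists_continuous_zero_iff_of_finite_fundamentalGroup x₀ hclosed hconn k
    (fun q hq => by
      obtain ⟨θ, hθ⟩ := hf.exists_isSideFunctionAt hdim hI hJ hN hq
      filter_upwards [hk q hq θ hθ, hθ.zero_iff] with y hy1 hy2
      rw [← hy2, ← sign_eq_zero_iff, hy1, sign_eq_zero_iff])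
  refine ⟨κ, hκ0, fun q hq θ hθ => ?_⟩
  filter_upwards [hκ q hq, hk q hq θ hθ] with y h1 h2
  exact h1.trans h2

/-- A side function along a transversal curve changes its sign at a crossing, in the direction given
by the sign of `g(γ', N)`. -/
theorem IsProperEmbedding.crossing [IsManifold I ∞ M] [IsManifold J ∞ S]
    (hI : IsBoundaryModel I) (hJ : IsBoundaryModel J)
    {f : S → M} (hf : IsProperEmbedding I J f)
    {g : Bundle.ContMDiffRiemannianMetric I ∞ E (fun p : M ↦ TangentSpace I p)}
    {N : ∀ p : M, TangentSpace I p} (hN : IsUnitNormalField I J g f N)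
    {γ : ℝ → M} (hγ : MDifferentiableOn 𝓘(ℝ, ℝ) I γ (Icc (0 : ℝ) 1)) (htr : IsTransversal I J f γ)
    {t : ℝ} (ht : t ∈ Ioo (0 : ℝ) 1) (htf : γ t ∈ range f) {θ : M → ℝ}
    (hθ : IsSideFunctionAt I (range f) N θ (γ t)) :
    g.inner (γ t) (velocity I γ t) (N (γ t)) ≠ 0 ∧
      (∀ᶠ s in 𝓝[<] t, g.inner (γ t) (velocity I γ t) (N (γ t)) * θ (γ s) < 0) ∧
      ∀ᶠ s in 𝓝[>] t, 0 < g.inner (γ t) (velocity I γ t) (N (γ t)) * θ (γ s) := by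
  set a : ℝ := g.inner (γ t) (velocity I γ t) (N (γ t)) with ha
  have htI : t ∈ Icc (0 : ℝ) 1 := Ioo_subset_Icc_self ht
  -- With `N = c γ' + w` and `w` tangent, applying `dθ` gives `c * d > 0` and pairing with `N` gives
  -- `c * a = 1`; thus `a` and `d` have the same sign.
  obtain ⟨c, w, hw, hNw⟩ := htr t htI htf (N (γ t))
  set d : ℝ := mfderiv I 𝓘(ℝ, ℝ) θ (γ t) (velocity I γ t) with hd
  have hcd : 0 < c * d := by
    have h1 := hθ.pos
    have h2 : (mfderiv I 𝓘(ℝ, ℝ) θ (γ t) (N (γ t)) : ℝ) = c * d := by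
      rw [hNw, map_add, map_smul, hf.mfderiv_apply_eq_zero hI hJ hθ hw]
      exact add_zero _
    rwa [h2] at h1
  have hca : c * a = 1 := by
    have hwN : g.inner (γ t) w (N (γ t)) = 0 :=
      (g.symm (γ t) w (N (γ t))).trans (hN.normal _ htf w hw)
    calc c * a = g.inner (γ t) (c • velocity I γ t + w) (N (γ t)) := by
          rw [map_add, map_smul, add_apply, hwN, add_zero]
          rfl
      _ = g.inner (γ t) (N (γ t)) (N (γ t)) := by rw [← hNw]
      _ = 1 := hN.unit _ htf
  have hmd : MDifferentiableAt 𝓘(ℝ, ℝ) I γ t := (hγ t htI).mdifferentiableAt (Icc_mem_nhds ht.1 ht.2)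
  have hvel : velocity I γ t = mfderiv 𝓘(ℝ, ℝ) I γ t (1 : ℝ) := by
    rw [velocity, mfderivWithin_of_mem_nhds (Icc_mem_nhds ht.1 ht.2)]
  have hder : HasDerivAt (θ ∘ γ) d t := by
    have h1 := (hθ.contMDiffAt.mdifferentiableAt one_ne_zero).hasMFDerivAt.comp t hmd.hasMFDerivAt
    let D : ℝ →L[ℝ] ℝ :=
      (mfderiv I 𝓘(ℝ, ℝ) θ (γ t)).comp (mfderiv 𝓘(ℝ, ℝ) I γ t)
    have h2 : HasFDerivAt (θ ∘ γ) D t := h1.hasFDerivAt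
    rw [hd, hvel]
    exact h2.hasDerivAt
  have hθ0 : (θ ∘ γ) t = 0 := hθ.zero_iff.self_of_nhds.mpr htf
  have hda : HasDerivAt (fun s => a * θ (γ s)) (a * d) t := hder.const_mul a
  have had : 0 < a * d := by
    have h1 : (c * a) * (c * d) = c ^ 2 * (a * d) := by ring
    rw [hca, one_mul] at h1
    by_contra! h2
    nlinarith [mul_nonneg (sq_nonneg c) (neg_nonneg.mpr h2)]
  refine ⟨fun h => by simp [h] at hca, ?_⟩
  exact eventually_lt_and_gt_of_hasDerivAt_pos hda (by simpa using Or.inr hθ0) had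

end

/-! ### The alternating property -/

theorem proposition4p1
    -- the ambient Riemannian manifold `(M, g)`, connected, possibly with boundary
    {E : Type*} [NormedAddCommGroup E] [NormedSpace ℝ E] [FiniteDimensional ℝ E]
    {H : Type*} [TopologicalSpace H] (I : ModelWithCorners ℝ E H) (hI : IsBoundaryModel I)
    {M : Type*} [TopologicalSpace M] [ChartedSpace H M] [IsManifold I ∞ M]
    [T2Space M] [SecondCountableTopology M] [ConnectedSpace M]
    (g : Bundle.ContMDiffRiemannianMetric I ∞ E (fun p : M ↦ TangentSpace I p))
    -- its fundamental group is finite, of order `ℓ`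
    (x₀ : M) [Finite (FundamentalGroup M x₀)] (ℓ : ℕ) (hℓ : Nat.card (FundamentalGroup M x₀) = ℓ)
    -- the connected hypersurface `f(S)`, properly embedded
    {F : Type*} [NormedAddCommGroup F] [NormedSpace ℝ F] [FiniteDimensional ℝ F]
    (hdim : Module.finrank ℝ E = Module.finrank ℝ F + 1)
    {G : Type*} [TopologicalSpace G] (J : ModelWithCorners ℝ F G) (hJ : IsBoundaryModel J)
    {S : Type*} [TopologicalSpace S] [ChartedSpace G S] [IsManifold J ∞ S] [ConnectedSpace S]
    (f : S → M) (hf : IsProperEmbedding I J f)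
    -- two-sided, with unit normal vector field `N`
    (N : ∀ p : M, TangentSpace I p) (hN : IsUnitNormalField I J g f N) :
    IsAlternating I J g f N ℓ := by
  intro γ hγ hγ0 hγ1 htr
  obtain ⟨κ, hκ0, hκ⟩ := hf.exists_global_side_function hdim hI hJ x₀ hN
  let a : ℝ → ℝ := fun t => g.inner (γ t) (velocity I γ t) (N (γ t))
  have hclosed : IsClosed (range f) := hf.isProperMap.isClosed_range
  set T : Set ℝ := {τ | τ ∈ Icc (0 : ℝ) 1 ∧ γ τ ∈ range f} with hT
  have hTioo : ∀ t ∈ T, t ∈ Ioo (0 : ℝ) 1 := by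
    rintro t ⟨ht, htf⟩
    refine ⟨lt_of_le_of_ne ht.1 ?_, lt_of_le_of_ne ht.2 ?_⟩
    · rintro rfl; exact hγ0 htf
    · rintro rfl; exact hγ1 htf
  have hcross : ∀ t ∈ T, a t ≠ 0 ∧ (∀ᶠ s in 𝓝[<] t, a t * κ (γ s) < 0) ∧
      ∀ᶠ s in 𝓝[>] t, 0 < a t * κ (γ s) := by
    intro t ht
    obtain ⟨θ, hθ⟩ := hf.exists_isSideFunctionAt hdim hI hJ hN ht.2
    obtain ⟨h1, h2, h3⟩ := hf.crossing hI hJ hN hγ htr (hTioo t ht) ht.2 hθ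
    have hcont : ContinuousAt γ t := (hγ.continuousOn t ht.1).continuousAt
      (Icc_mem_nhds (hTioo t ht).1 (hTioo t ht).2)
    have h4 : ∀ᶠ s in 𝓝 t, SignType.sign (a t * κ (γ s)) = SignType.sign (a t * θ (γ s)) := by
      filter_upwards [hcont.eventually (hκ _ ht.2 θ hθ)] with s hs
      rw [sign_mul, sign_mul, hs]
    refine ⟨h1, ?_, ?_⟩
    · filter_upwards [h2, mem_nhdsWithin_of_mem_nhds h4] with s hs1 hs2
      rw [sign_neg hs1] at hs2
      exact sign_eq_neg_one_iff.mp hs2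
    · filter_upwards [h3, mem_nhdsWithin_of_mem_nhds h4] with s hs1 hs2
      rw [sign_pos hs1] at hs2
      exact sign_eq_one_iff.mp hs2
  have hTclosed : IsClosed T := hγ.continuousOn.preimage_isClosed_of_isClosed isClosed_Icc hclosed
  have hTcompact : IsCompact T := isCompact_Icc.of_isClosed_subset hTclosed fun t ht => ht.1
  -- Infinitely many crossings would accumulate at a crossing, but the strict sign change of `κ ∘ γ`
  -- isolates each one.
  have hTfin : T.Finite := by
    by_contra hinf
    obtain ⟨t, ht, hacc⟩ := Set.Infinite.exists_accPt_of_subset_isCompact hinf hTcompact subset_rfl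
    obtain ⟨-, h2, h3⟩ := hcross t ht
    have h4 : ∀ᶠ s in 𝓝[≠] t, s ∉ T := by
      rw [← Iio_union_Ioi, nhdsWithin_union, eventually_sup]
      refine ⟨h2.mono fun s hs hsT => ?_, h3.mono fun s hs hsT => ?_⟩
      · rw [(hκ0 _).mpr hsT.2, mul_zero] at hs
        exact lt_irrefl _ hs
      · rw [(hκ0 _).mpr hsT.2, mul_zero] at hs
        exact lt_irrefl _ hs
    rw [accPt_iff_frequently_nhdsNE] at hacc
    exact hacc h4
  let e := hTfin.toFinset.orderEmbOfFin rfl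
  have hrange : range e = T := by
    rw [Finset.range_orderEmbOfFin, Finite.coe_toFinset]
  refine ⟨hTfin.toFinset.card, e, e.strictMono, hrange, ?_⟩
  have hℓ1 : 1 ≤ ℓ := by rw [← hℓ]; exact Nat.card_pos
  by_cases hn : hTfin.toFinset.card ≤ 1
  · left; omega
  · right
    rw [not_le] at hn
    -- The first two crossings, indexed from `0`, always work: `2 ≤ ℓ + 1` needs only `1 ≤ ℓ`.
    refine ⟨⟨0, by omega⟩, ⟨1, hn⟩, rfl, by simpa using hℓ1, ?_⟩
    have hmem : ∀ i, e i ∈ T := fun i => hrange.le (mem_range_self i)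
    have hlt : e ⟨0, by omega⟩ < e ⟨1, hn⟩ := e.strictMono (by simp)
    refine mul_neg_of_consecutive_zeros (h := fun s => κ (γ s)) (a := a)
      (κ.continuous.comp_continuousOn hγ.continuousOn) (hmem _).1 (hmem _).1 hlt ?_
      (hcross _ (hmem _)).1 (hcross _ (hmem _)).1 (hcross _ (hmem _)).2.2 (hcross _ (hmem _)).2.1
    intro r hr h0
    have hrT : r ∈ T := ⟨⟨(hmem _).1.1.trans hr.1.le, hr.2.le.trans (hmem _).1.2⟩, (hκ0 _).mp h0⟩
    obtain ⟨i, rfl⟩ := hrange.ge hrT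
    have h1 := e.lt_iff_lt.mp hr.1
    have h2 := e.lt_iff_lt.mp hr.2
    rw [Fin.lt_def] at h1 h2
    simp only at h1 h2
    omega
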